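/- Let $-\infty<a<b<\infty$ and let $p,q,r$ be real-valued functions on $(a,b)$ with $p>0$ and $r>0$ a.e. and $r,\,1/p,\,q\in L^1((a,b);dx)$. Put $\tau u=\frac1r\big[-(u^{[1]})'+qu\big]$ with $u^{[1]}=pu'$, and let $\operatorname{dom}(H_{\max})$ be the set of $g\in L^2((a,b);r\,dx)$ with $g,g^{[1]}\in AC([a,b])$ and $\tau g\in L^2((a,b);r\,dx)$. For $A,B\in\mathbb C^{2\times2}$ let $$\gamma_{A,B}u=A\binom{u(a)}{u^{[1]}(a)}-B\binom{u(b)}{u^{[1]}(b)},\quad D_{A,B}=\begin{pmatrix}A_{1,1}&-B_{1,1}\\A_{2,1}&-B_{2,1}\end{pmatrix},\quad N_{A,B}=\begin{pmatrix}A_{1,2}&B_{1,2}\\A_{2,2}&B_{2,2}\end{pmatrix},$$ and let $H_{A,B}$ be the operator $f\mapsto\tau f$ in $L^2((a,b);r\,dx)$ with domain $\{g\in\operatorname{dom}(H_{\max}) : \gamma_{A,B}g=0\}$. Let $A,B,A',B'\in\mathbb C^{2\times2}$ be such that $(A,B)$ and $(A',B')$ both satisfy $$\operatorname{rank}(A\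 \ B)=2,\qquad AJA^*=BJB^*,\qquad J=\begin{pmatrix}0&-1\\1&0\end{pmatrix}.$$ For $z$ in the resolvent set $\rho(H_{A,B})$ let $\Lambda_{A,B}^{A',B'}(z)\in\mathbb C^{2\times2}$ be the boundary data map, that is, the matrix with $\Lambda_{A,B}^{A',B'}(z)\,c=\gamma_{A',B'}u$ for $c\in\mathbb C^2$, where $u$ is the unique solution of $-(u^{[1]})'+qu=zru$ with $u,u^{[1]}\in AC([a,b])$ and $\gamma_{A,B}u=c$. Put $$S_{A',B',A,B}=N_{A',B'}D_{A,B}^*-D_{A',B'}N_{A,B}^*.$$ If $S_{A',B',A,B}$ is invertible, then $\mathbb C_+=\{z\in\mathbb C:\operatorname{Im}z>0\}\subset\rho(H_{A,B})$, and $M(z)=\Lambda_{A,B}^{A',B'}(z)\,S_{A',B',A,B}^*$ is a $2\times2$ matrix-valued Nevanlinna--Herglotz function (it is analytic on $\mathbb C_+$ with $\operatorname{Im}M(z)=\frac1{2i}(M(z)-M(z)^*)\ge0$ there), and moreover $\operatorname{Im}M(z)$ is positive definite for all $z\in\mathbb C_+$. -/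

import Mathlib

open MeasureTheory Set
open scoped ComplexOrder

noncomputable section

/-! ### Sturm-Liouville coefficients on a finite interval -/

/-- A finite interval `(a, b)` with real coefficient functions `p, q, r` on it (only the values
of `p, q, r` on `(a, b)` matter). -/
structure SLCoeff where
  a : ℝ
  b : ℝ
  p : ℝ → ℝ
  q : ℝ → ℝ
  r : ℝ → ℝ

namespace SLCoeff

/-- Lebesgue measure on `(a, b)`. -/
def leb (L : SLCoeff) : Measure ℝ := volume.restrict (Ioo L.a L.b)

/-- The standing assumptions: `a < b`, `r > 0` a.e. and `r ∈ L¹`, `p > 0` a.e. and `1/p ∈ L¹`,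
and `q ∈ L¹` real-valued. -/
structure Regular (L : SLCoeff) : Prop where
  lt : L.a < L.b
  r_pos : ∀ᵐ x ∂L.leb, 0 < L.r x
  r_int : Integrable L.r L.leb
  p_pos : ∀ᵐ x ∂L.leb, 0 < L.p x
  p_inv_int : Integrable (fun x => (L.p x)⁻¹) L.leb
  q_int : Integrable L.q L.leb

/-- The weighted measure `r dx` on `(a, b)`. -/
def weight (L : SLCoeff) : Measure ℝ := L.leb.withDensity (fun x => ENNReal.ofReal (L.r x))

/-- The Hilbert space `L²((a, b); r dx)`. -/
abbrev L2 (L : SLCoeff) : Type := Lp ℂ 2 L.weight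

/-- `u, u₁ ∈ AC([a, b])`, and `u₁` is the (absolutely continuous version of the) first
quasi-derivative `u^{[1]} = p u'`. -/
def QuasiPair (L : SLCoeff) (u u₁ : ℝ → ℂ) : Prop :=
  AbsolutelyContinuousOnInterval u L.a L.b ∧ AbsolutelyContinuousOnInterval u₁ L.a L.b ∧
    ∀ᵐ x ∂L.leb, u₁ x = (L.p x : ℂ) * deriv u x

/-- The differential expression `τ u = (1/r) (-(u^{[1]})' + q u)`, where `u₁ = u^{[1]}`. -/
def tau (L : SLCoeff) (u u₁ : ℝ → ℂ) (x : ℝ) : ℂ :=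
  (L.r x : ℂ)⁻¹ * (-(deriv u₁ x) + (L.q x : ℂ) * u x)

/-- The Dirichlet trace `γ_D u = (u(a), u(b))`. -/
def traceD (L : SLCoeff) (u : ℝ → ℂ) : Fin 2 → ℂ := ![u L.a, u L.b]

/-- The Neumann trace `γ_N u = (u^{[1]}(a), -u^{[1]}(b))`, where `u₁ = u^{[1]}`. -/
def traceN (L : SLCoeff) (u₁ : ℝ → ℂ) : Fin 2 → ℂ := ![u₁ L.a, -u₁ L.b]

/-- The general boundary trace map
`γ_{A,B} u = A (u(a), u^{[1]}(a))ᵀ - B (u(b), u^{[1]}(b))ᵀ`, where `u₁ = u^{[1]}`. -/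
def trace (L : SLCoeff) (A B : Matrix (Fin 2) (Fin 2) ℂ) (u u₁ : ℝ → ℂ) : Fin 2 → ℂ :=
  A.mulVec ![u L.a, u₁ L.a] - B.mulVec ![u L.b, u₁ L.b]

end SLCoeff

/-! ### Boundary condition matrices -/

/-- The matrix `J = (0 -1; 1 0)`. -/
def bcJ : Matrix (Fin 2) (Fin 2) ℂ := !![0, -1; 1, 0]

/-- The conditions `rank (A B) = 2` and `A J A* = B J B*`. -/
def SelfAdjointBC (A B : Matrix (Fin 2) (Fin 2) ℂ) : Prop :=
  (Matrix.fromCols A B).rank = 2 ∧ A * bcJ * A.conjTranspose = B * bcJ * B.conjTranspose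

/-- The matrix `D_{A,B}`. -/
def matD (A B : Matrix (Fin 2) (Fin 2) ℂ) : Matrix (Fin 2) (Fin 2) ℂ :=
  !![A 0 0, -B 0 0; A 1 0, -B 1 0]

/-- The matrix `N_{A,B}`. -/
def matN (A B : Matrix (Fin 2) (Fin 2) ℂ) : Matrix (Fin 2) (Fin 2) ℂ :=
  !![A 0 1, B 0 1; A 1 1, B 1 1]

/-- The matrix `S_{A',B',A,B} = N_{A',B'} D_{A,B}* - D_{A',B'} N_{A,B}*`. -/
def matS (A' B' A B : Matrix (Fin 2) (Fin 2) ℂ) : Matrix (Fin 2) (Fin 2) ℂ :=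
  matN A' B' * (matD A B).conjTranspose - matD A' B' * (matN A B).conjTranspose

/-- `γ_{A,B} = D_{A,B} γ_D + N_{A,B} γ_N`. -/
theorem SLCoeff.trace_eq (L : SLCoeff) (A B : Matrix (Fin 2) (Fin 2) ℂ) (u u₁ : ℝ → ℂ) :
    L.trace A B u u₁ = (matD A B).mulVec (L.traceD u) + (matN A B).mulVec (L.traceN u₁) := by
  funext i
  fin_cases i <;>
    simp [SLCoeff.trace, SLCoeff.traceD, SLCoeff.traceN, matD, matN] <;> ring

/-! ### The operator `H_{A,B}` and resolvent sets -/

namespace SLCoeff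

theorem ae_diff {L : SLCoeff} {u : ℝ → ℂ} (hu : AbsolutelyContinuousOnInterval u L.a L.b) :
    ∀ᵐ x ∂L.leb, DifferentiableAt ℝ u x := by
  have h := hu.boundedVariationOn.ae_differentiableAt_of_mem_uIcc
  rw [leb, ae_restrict_iff' measurableSet_Ioo]
  filter_upwards [h] with x hx hx'
  exact hx (Ioo_subset_Icc_self.trans Icc_subset_uIcc hx')

theorem QuasiPair.zero {L : SLCoeff} : L.QuasiPair 0 0 := by
  have h0 : AbsolutelyContinuousOnInterval (0 : ℝ → ℂ) L.a L.b := by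
    rw [absolutelyContinuousOnInterval_iff]
    intro ε hε
    exact ⟨1, one_pos, fun E _ _ => by simpa using hε⟩
  exact ⟨h0, h0, by simp⟩

theorem QuasiPair.add {L : SLCoeff} {u u₁ v v₁ : ℝ → ℂ} (hu : L.QuasiPair u u₁) (hv : L.QuasiPair v v₁) :
    L.QuasiPair (u + v) (u₁ + v₁) := by
  refine ⟨hu.1.add hv.1, hu.2.1.add hv.2.1, ?_⟩
  filter_upwards [ae_diff hu.1, ae_diff hv.1, hu.2.2, hv.2.2] with x h1 h2 h3 h4
  rw [deriv_add h1 h2, Pi.add_apply, h3, h4]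
  ring

theorem QuasiPair.smul {L : SLCoeff} {u u₁ : ℝ → ℂ} (c : ℂ) (hu : L.QuasiPair u u₁) :
    L.QuasiPair (c • u) (c • u₁) := by
  refine ⟨hu.1.const_smul c, hu.2.1.const_smul c, ?_⟩
  filter_upwards [ae_diff hu.1, hu.2.2] with x h1 h3
  rw [deriv_const_smul c h1, Pi.smul_apply, h3, smul_eq_mul, smul_eq_mul]
  ring

theorem weight_ac {L : SLCoeff} : L.weight ≪ L.leb := withDensity_absolutelyContinuous _ _

/-- The pair `(u, u₁)` represents an element `f` of `dom(H_max)` (so `u₁ = u^{[1]}`), and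
`g = H_max f = τ f`. -/
def MaxRep (L : SLCoeff) (f g : L.L2) (u u₁ : ℝ → ℂ) : Prop :=
  L.QuasiPair u u₁ ∧ (f : ℝ → ℂ) =ᵐ[L.weight] u ∧ (g : ℝ → ℂ) =ᵐ[L.weight] L.tau u u₁

/-- The graph of `H_{A,B}`: the pairs `(f, τ f)` with `f ∈ dom(H_max)` and `γ_{A,B} f = 0`. -/
def extGraph (L : SLCoeff) (A B : Matrix (Fin 2) (Fin 2) ℂ) : Submodule ℂ (L.L2 × L.L2) where
  carrier := {fg | ∃ u u₁, L.MaxRep fg.1 fg.2 u u₁ ∧ L.trace A B u u₁ = 0}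
  zero_mem' := by
    refine ⟨0, 0, ⟨QuasiPair.zero, Lp.coeFn_zero _ _ _, ?_⟩, ?_⟩
    · filter_upwards [Lp.coeFn_zero ℂ 2 L.weight] with x hx
      simpa [tau] using hx
    · simp [trace_eq, traceD, traceN]
  add_mem' := by
    rintro ⟨f, g⟩ ⟨f', g'⟩ ⟨u, u₁, ⟨hq, hf, hg⟩, ht⟩ ⟨v, v₁, ⟨hq', hf', hg'⟩, ht'⟩
    refine ⟨u + v, u₁ + v₁, ⟨hq.add hq', ?_, ?_⟩, ?_⟩
    · filter_upwards [Lp.coeFn_add f f', hf, hf'] with x h1 h2 h3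
      simp only [Prod.mk_add_mk] at *
      rw [h1, Pi.add_apply, Pi.add_apply, h2, h3]
    · filter_upwards [Lp.coeFn_add g g', hg, hg', weight_ac (ae_diff hq.2.1),
        weight_ac (ae_diff hq'.2.1)] with x h1 h2 h3 h4 h5
      simp only [Prod.mk_add_mk] at *
      rw [h1, Pi.add_apply, h2, h3, tau, tau, tau, deriv_add h4 h5, Pi.add_apply]
      ring
    · have : L.trace A B (u + v) (u₁ + v₁) = L.trace A B u u₁ + L.trace A B v v₁ := by
        funext i
        fin_cases i <;> simp [trace] <;> ring
      rw [this, ht, ht', add_zero]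
  smul_mem' := by
    rintro c ⟨f, g⟩ ⟨u, u₁, ⟨hq, hf, hg⟩, ht⟩
    refine ⟨c • u, c • u₁, ⟨hq.smul c, ?_, ?_⟩, ?_⟩
    · filter_upwards [Lp.coeFn_smul c f, hf] with x h1 h2
      simp only [Prod.smul_mk] at *
      rw [h1, Pi.smul_apply, Pi.smul_apply, h2]
    · filter_upwards [Lp.coeFn_smul c g, hg, weight_ac (ae_diff hq.2.1)] with x h1 h2 h4
      simp only [Prod.smul_mk] at *
      rw [h1, Pi.smul_apply, h2, tau, tau, deriv_const_smul c h4, Pi.smul_apply]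
      simp only [smul_eq_mul]
      ring
    · have : L.trace A B (c • u) (c • u₁) = c • L.trace A B u u₁ := by
        funext i
        fin_cases i <;> simp [trace] <;> ring
      rw [this, ht, smul_zero]

/-- The operator `H_{A,B}` in `L²((a, b); r dx)`: `H_{A,B} f = τ f` on
`dom(H_{A,B}) = {f ∈ dom(H_max) | γ_{A,B} f = 0}`. -/
def opH (L : SLCoeff) (A B : Matrix (Fin 2) (Fin 2) ℂ) : L.L2 →ₗ.[ℂ] L.L2 :=
  (L.extGraph A B).toLinearPMap

/-- For regular coefficients `f ↦ τ f` is single-valued on classes of functions, so that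
`H_{A,B}` has the graph that its definition prescribes. -/
theorem opH_graph {L : SLCoeff} (hL : L.Regular) (A B : Matrix (Fin 2) (Fin 2) ℂ) :
    (L.opH A B).graph = L.extGraph A B := by
  refine Submodule.toLinearPMap_graph_eq _ ?_
  rintro ⟨f, g⟩ ⟨u, u₁, ⟨hq, hf, hg⟩, -⟩ (rfl : f = 0)
  have hac : L.leb ≪ L.weight := by
    refine withDensity_absolutelyContinuous' hL.r_int.aemeasurable.ennreal_ofReal ?_
    filter_upwards [hL.r_pos] with x hx
    simpa using hx
  have key : ∀ w : ℝ → ℂ, AbsolutelyContinuousOnInterval w L.a L.b → (∀ᵐ x ∂L.leb, w x = 0) →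
      ∀ x ∈ Ioo L.a L.b, w x = 0 := by
    intro w hw h0
    have hc : ContinuousOn w (Ioo L.a L.b) :=
      hw.continuousOn.mono (Ioo_subset_Icc_self.trans Icc_subset_uIcc)
    exact Measure.eqOn_open_of_ae_eq (f := w) (g := fun _ => 0) h0 isOpen_Ioo hc
      continuousOn_const
  have dkey : ∀ w : ℝ → ℂ, (∀ x ∈ Ioo L.a L.b, w x = 0) → ∀ x ∈ Ioo L.a L.b, deriv w x = 0 := by
    intro w hw x hx
    have : w =ᶠ[nhds x] fun _ => 0 := by
      filter_upwards [isOpen_Ioo.mem_nhds hx] with y hy using hw y hy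
    simp [this.deriv_eq]
  have hmem : ∀ᵐ x ∂L.leb, x ∈ Ioo L.a L.b := ae_restrict_mem measurableSet_Ioo
  have hu0 : ∀ x ∈ Ioo L.a L.b, u x = 0 := by
    refine key u hq.1 (hac ?_)
    filter_upwards [hf, Lp.coeFn_zero ℂ 2 L.weight] with x h1 h2
    rw [← h1, h2, Pi.zero_apply]
  have hv0 : ∀ x ∈ Ioo L.a L.b, u₁ x = 0 := by
    refine key u₁ hq.2.1 ?_
    filter_upwards [hq.2.2, hmem] with x h1 h2
    rw [h1, dkey u hu0 x h2, mul_zero]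
  refine Lp.ext ?_
  filter_upwards [hg, Lp.coeFn_zero ℂ 2 L.weight, weight_ac hmem] with x h1 h2 h3
  rw [h1, h2, tau, dkey u₁ hv0 x h3, hu0 x h3]
  simp

end SLCoeff

/-- The resolvent set `ρ(T)` of a linear operator `T` in `E`: the `z ∈ ℂ` such that `T - z` is a
bijection of `dom(T)` onto `E` with bounded inverse `R`. -/
def opResolventSet {E : Type*} [NormedAddCommGroup E] [NormedSpace ℂ E] (T : E →ₗ.[ℂ] E) :
    Set ℂ :=
  {z | ∃ R : E →L[ℂ] E,
    (∀ f : E, ∃ h : R f ∈ T.domain, T ⟨R f, h⟩ - z • R f = f) ∧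
    ∀ u : T.domain, R (T u - z • (u : E)) = u}

namespace SLCoeff

/-! ### The boundary data map -/

/-- `u` (with quasi-derivative `u₁`) is a solution of `-(u^{[1]})' + q u = z r u` on `(a, b)` with
`u, u^{[1]} ∈ AC([a, b])`. -/
def IsSolution (L : SLCoeff) (z : ℂ) (u u₁ : ℝ → ℂ) : Prop :=
  L.QuasiPair u u₁ ∧
    ∀ᵐ x ∂L.leb, -(deriv u₁ x) + (L.q x : ℂ) * u x = z * (L.r x : ℂ) * u x

/-- The solution `u_{A,B}(z, · ; c)` of the boundary value problem `-(u^{[1]})' + q u = z r u`,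
`γ_{A,B} u = c`, together with its quasi-derivative. For `z ∈ ρ(H_{A,B})` the solution exists and
both functions are unique on `[a, b]`; for other `z` nothing is claimed. -/
def bvpSol (L : SLCoeff) (A B : Matrix (Fin 2) (Fin 2) ℂ) (z : ℂ) (c : Fin 2 → ℂ) :
    (ℝ → ℂ) × (ℝ → ℂ) :=
  Classical.epsilon fun w => L.IsSolution z w.1 w.2 ∧ L.trace A B w.1 w.2 = c

open Classical in
/-- The boundary data map `Λ_{A,B}^{A',B'}(z)`, `z ∈ ρ(H_{A,B})`, as the matrix of the linear map
`c ↦ γ_{A',B'} u_{A,B}(z, · ; c)` (with the value `0` off its domain `ρ(H_{A,B})`). -/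
def boundaryDataMap (L : SLCoeff) (A B A' B' : Matrix (Fin 2) (Fin 2) ℂ) (z : ℂ) :
    Matrix (Fin 2) (Fin 2) ℂ :=
  if z ∈ opResolventSet (L.opH A B) then
    Matrix.of fun i j =>
      L.trace A' B' (L.bvpSol A B z (Pi.single j 1)).1 (L.bvpSol A B z (Pi.single j 1)).2 i
  else 0

end SLCoeff

/-! ### Matrix-valued Nevanlinna-Herglotz functions -/

/-- The open upper half-plane `ℂ₊`. -/
def upperHalf : Set ℂ := {z | 0 < z.im}

/-- The imaginary part `Im(M) = (M - M*) / (2i)` of a square matrix. -/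
def matIm {n : ℕ} (M : Matrix (Fin n) (Fin n) ℂ) : Matrix (Fin n) (Fin n) ℂ :=
  (2 * Complex.I)⁻¹ • (M - M.conjTranspose)

/-- `M` is a matrix-valued Nevanlinna-Herglotz function: it is analytic on `ℂ₊` and
`Im(M(z)) ≥ 0` for all `z ∈ ℂ₊`. -/
def IsNevanlinnaHerglotz {n : ℕ} (M : ℂ → Matrix (Fin n) (Fin n) ℂ) : Prop :=
  (∀ i j, AnalyticOnNhd ℂ (fun z => M z i j) upperHalf) ∧
    ∀ z ∈ upperHalf, (matIm (M z)).PosSemidef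

end

noncomputable section

open Matrix

/-! ### Absolutely continuous functions -/

namespace AbsolutelyContinuousOnInterval

/-! Positivity comes from evaluating one boundary form in two ways. Analytically, Green's identity
gives Im(γ_D u* γ_N u) = Im z ∫ r|u|² for every solution u (`green_solution`). Algebraically, let T
be the block matrix with rows (D N) and (D' N'); it sends (γ_D u, γ_N u) to (γ_{A,B} u, γ_{A',B'}
u). Self-adjointness of both pairs makes T W T* block antidiagonal with entries S* and -S, where W
is the standard symplectic matrix. For invertible S the boundary form therefore becomes d*c' - c'*d,
with γ_{A,B} u = S*d and c' = γ_{A',B'} u (`boundary_form_eq`). Since c' = M(z)d, comparison yields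
d* Im M(z) d = Im z ∫ r|u|², which vanishes only if u has zero boundary values, that is, S*d = 0 and
d = 0 (`posDef_matIm`).

The case d = 0 shows that a solution with γ_{A,B} u = 0 has no nonzero boundary values when Im z >
0, so the characteristic matrix A - B·(monodromy) is invertible (`isUnit_det_charMat`) and H_{A,B} -
z is onto. Green's identity with a source term bounds H_{A,B} - z from below by Im z, which puts z
in the resolvent set.

For analyticity, the initial value problem is a fixed-point equation y = h + T(z)y with T(z) affine
in z and 1 - T(z) always invertible. Hence the monodromy matrix is entire, and Λ is a quotient of
two characteristic matrices (`boundaryDataMap_eq`). -/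

theorem lipschitz_comp {X Y : Type*} [PseudoMetricSpace X] [PseudoMetricSpace Y] {f : ℝ → X}
    {g : X → Y} {a b : ℝ} {K : NNReal} {s : Set X} (hf : AbsolutelyContinuousOnInterval f a b)
    (hg : LipschitzOnWith K g s) (hs : ∀ x ∈ uIcc a b, f x ∈ s) :
    AbsolutelyContinuousOnInterval (fun x => g (f x)) a b := by
  rw [absolutelyContinuousOnInterval_iff] at hf ⊢
  intro ε hε
  -- Using `K + 1` instead of `K` keeps the quotient meaningful when `K = 0`.
  obtain ⟨δ, hδ, H⟩ := hf (ε / (K + 1)) (by positivity)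
  refine ⟨δ, hδ, fun E hE hlt => ?_⟩
  have h1 := H E hE hlt
  calc ∑ i ∈ Finset.range E.1, dist (g (f (E.2 i).1)) (g (f (E.2 i).2))
      ≤ ∑ i ∈ Finset.range E.1, (K + 1) * dist (f (E.2 i).1) (f (E.2 i).2) := by
        refine Finset.sum_le_sum fun i hi => ?_
        refine (hg.dist_le_mul _ (hs _ (hE.1 i hi).1) _ (hs _ (hE.1 i hi).2)).trans ?_
        gcongr
        linarith
    _ = (K + 1) * ∑ i ∈ Finset.range E.1, dist (f (E.2 i).1) (f (E.2 i).2) := by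
        rw [Finset.mul_sum]
    _ < (K + 1) * (ε / (K + 1)) := by gcongr
    _ = ε := by field_simp

theorem re {f : ℝ → ℂ} {a b : ℝ} (hf : AbsolutelyContinuousOnInterval f a b) :
    AbsolutelyContinuousOnInterval (fun x => (f x).re) a b :=
  hf.lipschitz_comp (Complex.reCLM.lipschitz.lipschitzOnWith (s := univ)) fun _ _ => mem_univ _

theorem im {f : ℝ → ℂ} {a b : ℝ} (hf : AbsolutelyContinuousOnInterval f a b) :
    AbsolutelyContinuousOnInterval (fun x => (f x).im) a b :=
  hf.lipschitz_comp (Complex.imCLM.lipschitz.lipschitzOnWith (s := univ)) fun _ _ => mem_univ _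

theorem ofReal {f : ℝ → ℝ} {a b : ℝ} (hf : AbsolutelyContinuousOnInterval f a b) :
    AbsolutelyContinuousOnInterval (fun x => (f x : ℂ)) a b :=
  hf.lipschitz_comp (Complex.ofRealCLM.lipschitz.lipschitzOnWith (s := univ)) fun _ _ => mem_univ _

theorem exp {f : ℝ → ℝ} {a b : ℝ} (hf : AbsolutelyContinuousOnInterval f a b) :
    AbsolutelyContinuousOnInterval (fun x => Real.exp (f x)) a b := by
  obtain ⟨C, hC⟩ := hf.exists_bound
  -- The exponential is Lipschitz only on bounded sets, hence the restriction to the range bound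
  -- `C`.
  obtain ⟨K, hK⟩ := (Real.contDiff_exp (n := 1)).contDiffOn.exists_lipschitzOnWith (by decide)
    (convex_Icc (-C) C) isCompact_Icc
  exact hf.lipschitz_comp hK fun x hx => abs_le.mp (hC x hx)

theorem const {X : Type*} [PseudoMetricSpace X] (c : X) (a b : ℝ) :
    AbsolutelyContinuousOnInterval (fun _ : ℝ => c) a b := by
  rw [absolutelyContinuousOnInterval_iff]
  exact fun ε hε => ⟨1, one_pos, fun E _ _ => by simpa using hε⟩

theorem complex_integral {f : ℝ → ℂ} {a b : ℝ} (hab : a ≤ b) (h : IntervalIntegrable f volume a b) :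
    AbsolutelyContinuousOnInterval (fun x => ∫ t in a..x, f t) a b := by
  have hre : IntervalIntegrable (fun t => (f t).re) volume a b := ⟨h.1.re, h.2.re⟩
  have him : IntervalIntegrable (fun t => (f t).im) volume a b := ⟨h.1.im, h.2.im⟩
  have h1 := (hre.absolutelyContinuousOnInterval_intervalIntegral left_mem_uIcc).ofReal
  have h2 := (him.absolutelyContinuousOnInterval_intervalIntegral left_mem_uIcc).ofReal.const_smul
    Complex.I
  have h3 := h1.add h2
  rw [absolutelyContinuousOnInterval_iff] at h3 ⊢
  intro ε hε
  obtain ⟨δ, hδ, H⟩ := h3 ε hε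
  refine ⟨δ, hδ, fun E hE hlt => (Finset.sum_congr rfl fun i hi => ?_).trans_lt (H E hE hlt)⟩
  -- Absolute continuity tests only points of the interval, so agreement there with the sum of the
  -- real and imaginary parts is enough.
  have key : ∀ x ∈ uIcc a b, ∫ t in a..x, f t =
      ((∫ t in a..x, (f t).re : ℝ) : ℂ) + Complex.I • ((∫ t in a..x, (f t).im : ℝ) : ℂ) := by
    intro x hx
    rw [uIcc_of_le hab] at hx
    have hx' : IntervalIntegrable f volume a x := h.mono_set (by
      rw [uIcc_of_le hab, uIcc_of_le hx.1]
      exact Icc_subset_Icc_right hx.2)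
    apply Complex.ext
    · have := Complex.reCLM.intervalIntegral_comp_comm hx'
      simp only [Complex.reCLM_apply] at this
      simp [this]
    · have := Complex.imCLM.intervalIntegral_comp_comm hx'
      simp only [Complex.imCLM_apply] at this
      simp [this]
  simp only [Pi.add_apply]
  rw [key _ (hE.1 i hi).1, key _ (hE.1 i hi).2]

end AbsolutelyContinuousOnInterval

/-! ### Indefinite integrals on (a, b) -/

namespace SLCoeff

theorem Regular.intervalIntegrable {L : SLCoeff} (hL : L.Regular) {E : Type*} [NormedAddCommGroup E]
    {f : ℝ → E} (hf : Integrable f L.leb) : IntervalIntegrable f volume L.a L.b :=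
  (intervalIntegrable_iff_integrableOn_Ioo_of_le hL.lt.le).mpr hf

theorem Regular.intervalIntegral_eq {L : SLCoeff} (hL : L.Regular) (f : ℝ → ℝ) :
    ∫ t in L.a..L.b, f t = ∫ t, f t ∂L.leb := by
  rw [intervalIntegral.integral_of_le hL.lt.le, integral_Ioc_eq_integral_Ioo, leb]

theorem ae_leb_of_uIcc {L : SLCoeff} {P : ℝ → Prop} (h : ∀ᵐ x, x ∈ uIcc L.a L.b → P x) :
    ∀ᵐ x ∂L.leb, P x := by
  rw [leb, ae_restrict_iff' measurableSet_Ioo]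
  filter_upwards [h] with x hx hx'
  exact hx (Ioo_subset_Icc_self.trans Icc_subset_uIcc hx')

/-- An indefinite integral of an integrable function has that function as derivative a.e. -/
theorem Regular.ae_deriv_integral {L : SLCoeff} (hL : L.Regular) {f : ℝ → ℂ}
    (hf : Integrable f L.leb) (c : ℂ) :
    ∀ᵐ x ∂L.leb, deriv (fun y => c + ∫ t in L.a..y, f t) x = f x := by
  refine ae_leb_of_uIcc ?_
  filter_upwards [(hL.intervalIntegrable hf).ae_hasDerivAt_integral] with x hx hx'
  exact ((hx hx' L.a left_mem_uIcc).const_add c).deriv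

theorem Regular.ac_integral {L : SLCoeff} (hL : L.Regular) {f : ℝ → ℂ}
    (hf : Integrable f L.leb) (c : ℂ) :
    AbsolutelyContinuousOnInterval (fun y => c + ∫ t in L.a..y, f t) L.a L.b :=
  (AbsolutelyContinuousOnInterval.const c _ _).add
    (AbsolutelyContinuousOnInterval.complex_integral hL.lt.le (hL.intervalIntegrable hf))

/-- The integral of `κ exp (2 ∫ κ)` is dominated by half of the exponential weight. -/
theorem integral_mul_exp_le {a x : ℝ} {κ : ℝ → ℝ}
    (hκ : IntervalIntegrable κ volume a x) :
    ∫ t in a..x, κ t * Real.exp (2 * ∫ s in a..t, κ s) ≤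
      Real.exp (2 * ∫ s in a..x, κ s) / 2 := by
  have hac := (hκ.absolutelyContinuousOnInterval_intervalIntegral left_mem_uIcc).const_mul 2
  have h1 := hac.exp.integral_deriv_eq_sub
  have h2 : ∫ t in a..x, deriv (fun y => Real.exp (2 * ∫ s in a..y, κ s)) t =
      ∫ t in a..x, 2 * (κ t * Real.exp (2 * ∫ s in a..t, κ s)) := by
    apply intervalIntegral.integral_congr_ae
    filter_upwards [hκ.ae_hasDerivAt_integral] with t ht ht'
    have := (((ht (uIoc_subset_uIcc ht') a left_mem_uIcc).const_mul 2).exp).deriv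
    rw [this]
    ring
  rw [h2, intervalIntegral.integral_const_mul] at h1
  simp only [intervalIntegral.integral_same, mul_zero, Real.exp_zero] at h1
  linarith

end SLCoeff

/-! ### Volterra integral operators and the initial value problem -/

/-- A similarity amounts to passing to an equivalent norm: the Neumann series needs a contraction
only after conjugation. This permits Volterra operators of arbitrarily large norm. -/
theorem isUnit_one_sub_of_conj {X : Type*} [NormedAddCommGroup X] [NormedSpace ℂ X]
    [CompleteSpace X] {P Q T : X →L[ℂ] X} (hPQ : P * Q = 1) (hQP : Q * P = 1)
    (h : ‖Q * T * P‖ < 1) : IsUnit (1 - T) := by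
  have heq : 1 - T = P * (1 - Q * T * P) * Q := by
    rw [mul_sub, sub_mul, mul_one, hPQ]
    congr 1
    calc T = (P * Q) * T * (P * Q) := by rw [hPQ, one_mul, mul_one]
      _ = _ := by simp only [mul_assoc]
  rw [heq]
  exact ((⟨P, Q, hPQ, hQP⟩ : (X →L[ℂ] X)ˣ).isUnit.mul (isUnit_one_sub_of_norm_lt_one h)).mul
    (⟨Q, P, hQP, hPQ⟩ : (X →L[ℂ] X)ˣ).isUnit

/-- Inversion is holomorphic on the units of a Banach algebra, and the family is affine in `z`. This
is the source of all holomorphy in `z` below. -/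
theorem differentiable_inverse_one_sub_apply {X : Type*} [NormedAddCommGroup X] [NormedSpace ℂ X]
    [CompleteSpace X] (S T : X →L[ℂ] X) (hu : ∀ z : ℂ, IsUnit (1 - (S + z • T))) (x : X) :
    Differentiable ℂ fun z : ℂ => Ring.inverse (1 - (S + z • T)) x := by
  have h1 : Differentiable ℂ fun z : ℂ => 1 - (S + z • T) := by fun_prop
  intro z
  have h2 : DifferentiableAt ℂ (fun z : ℂ => Ring.inverse (1 - (S + z • T))) z :=
    DifferentiableAt.fun_comp' z (g := Ring.inverse) (differentiableAt_inverse (𝕜 := ℂ) (hu z)) (h1 z)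
  exact h2.clm_apply (differentiableAt_const x)

namespace SLCoeff

variable {L : SLCoeff}

theorem Regular.integrable_mul (hL : L.Regular) {k : ℝ → ℂ} (hk : Integrable k L.leb) {f : ℝ → ℂ}
    (hf : ContinuousOn f (Icc L.a L.b)) : Integrable (fun t => k t * f t) L.leb :=
  (intervalIntegrable_iff_integrableOn_Ioo_of_le hL.lt.le).mp
    ((hL.intervalIntegrable hk).mul_continuousOn (by rwa [uIcc_of_le hL.lt.le]))

theorem Regular.intervalIntegrable_left (hL : L.Regular) {E : Type*} [NormedAddCommGroup E]
    {f : ℝ → E} (hf : Integrable f L.leb) {x : ℝ} (hx : x ∈ Icc L.a L.b) :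
    IntervalIntegrable f volume L.a x :=
  (hL.intervalIntegrable hf).mono_set (by
    rw [uIcc_of_le hL.lt.le, uIcc_of_le hx.1]
    exact Icc_subset_Icc_right hx.2)

/-- The extension of a continuous function on `[a, b]` to the line. -/
def Regular.ext (hL : L.Regular) (f : C(Icc L.a L.b, ℂ)) : ℝ → ℂ := IccExtend hL.lt.le f

theorem Regular.ext_apply (hL : L.Regular) (f : C(Icc L.a L.b, ℂ)) {x : ℝ}
    (hx : x ∈ Icc L.a L.b) : hL.ext f x = f ⟨x, hx⟩ := IccExtend_of_mem _ _ hx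

theorem Regular.continuous_ext (hL : L.Regular) (f : C(Icc L.a L.b, ℂ)) :
    Continuous (hL.ext f) := f.continuous.Icc_extend'

theorem Regular.norm_ext_le (hL : L.Regular) (f : C(Icc L.a L.b, ℂ)) (x : ℝ) :
    ‖hL.ext f x‖ ≤ ‖f‖ := f.norm_coe_le_norm _

theorem Regular.integrable_mul_ext (hL : L.Regular) {k : ℝ → ℂ} (hk : Integrable k L.leb)
    (f : C(Icc L.a L.b, ℂ)) : Integrable (fun t => k t * hL.ext f t) L.leb :=
  hL.integrable_mul hk (hL.continuous_ext f).continuousOn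

/-- The indefinite integral from `a`, as a continuous function on `[a, b]`. -/
def Regular.primitive (hL : L.Regular) {f : ℝ → ℂ} (hf : Integrable f L.leb) :
    C(Icc L.a L.b, ℂ) where
  toFun x := ∫ t in L.a..x, f t
  continuous_toFun := by
    have h := (AbsolutelyContinuousOnInterval.complex_integral hL.lt.le
      (hL.intervalIntegrable hf)).continuousOn
    rw [uIcc_of_le hL.lt.le] at h
    exact continuousOn_iff_continuous_domRestrict.mp h

/-- The Volterra operator `f ↦ ∫ₐˣ k f`. -/
def Regular.volterra (hL : L.Regular) {k : ℝ → ℂ} (hk : Integrable k L.leb) :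
    C(Icc L.a L.b, ℂ) →L[ℂ] C(Icc L.a L.b, ℂ) :=
  LinearMap.mkContinuous
    { toFun := fun f => hL.primitive (hL.integrable_mul_ext hk f)
      map_add' := fun f g => by
        ext x
        change ∫ t in L.a..x, k t * hL.ext (f + g) t =
          (∫ t in L.a..x, k t * hL.ext f t) + ∫ t in L.a..x, k t * hL.ext g t
        rw [← intervalIntegral.integral_add
          (hL.intervalIntegrable_left (hL.integrable_mul_ext hk f) x.2)
          (hL.intervalIntegrable_left (hL.integrable_mul_ext hk g) x.2)]
        congr 1
        ext t
        rw [← mul_add]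
        rfl
      map_smul' := fun c f => by
        ext x
        change ∫ t in L.a..x, k t * hL.ext (c • f) t = c • ∫ t in L.a..x, k t * hL.ext f t
        rw [← intervalIntegral.integral_smul]
        congr 1
        ext t
        exact mul_smul_comm c (k t) (hL.ext f t) }
    (∫ t in L.a..L.b, ‖k t‖) (fun f => by
      have h0 : 0 ≤ ∫ t in L.a..L.b, ‖k t‖ :=
        intervalIntegral.integral_nonneg hL.lt.le fun _ _ => norm_nonneg _
      refine (ContinuousMap.norm_le _ (by positivity)).mpr fun x => ?_
      have hi := hL.intervalIntegrable_left hk.norm x.2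
      calc ‖∫ t in L.a..x, k t * hL.ext f t‖ ≤ ∫ t in L.a..x, ‖k t‖ * ‖f‖ := by
            refine intervalIntegral.norm_integral_le_of_norm_le x.2.1 ?_ (hi.mul_const _)
            refine Filter.Eventually.of_forall fun t _ => ?_
            rw [norm_mul]
            gcongr
            exact hL.norm_ext_le f t
        _ = (∫ t in L.a..x, ‖k t‖) * ‖f‖ := intervalIntegral.integral_mul_const _ _
        _ ≤ (∫ t in L.a..L.b, ‖k t‖) * ‖f‖ := by
            gcongr
            exact intervalIntegral.integral_mono_interval le_rfl x.2.1 x.2.2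
              (Filter.Eventually.of_forall fun _ => norm_nonneg _)
              (hL.intervalIntegrable hk.norm))

theorem Regular.volterra_apply (hL : L.Regular) {k : ℝ → ℂ} (hk : Integrable k L.leb)
    (f : C(Icc L.a L.b, ℂ)) (x : Icc L.a L.b) :
    hL.volterra hk f x = ∫ t in L.a..x, k t * hL.ext f t := rfl

/-- The exponential weight `exp (2 ∫ₐˣ κ)`. -/
def Regular.expWeight (hL : L.Regular) {κ : ℝ → ℝ} (hκ : Integrable κ L.leb) :
    C(Icc L.a L.b, ℝ) where
  toFun x := Real.exp (2 * ∫ t in L.a..x, κ t)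
  continuous_toFun := by
    have h := ((hL.intervalIntegrable hκ).absolutelyContinuousOnInterval_intervalIntegral
      left_mem_uIcc).continuousOn
    rw [uIcc_of_le hL.lt.le] at h
    have h2 : Continuous fun x : Icc L.a L.b => ∫ t in L.a..x, κ t :=
      continuousOn_iff_continuous_domRestrict.mp h
    fun_prop

theorem Regular.expWeight_pos (hL : L.Regular) {κ : ℝ → ℝ} (hκ : Integrable κ L.leb)
    (x : Icc L.a L.b) : 0 < hL.expWeight hκ x := Real.exp_pos _

/-- The exponential weight as a complex-valued function. -/
def Regular.cWeight (hL : L.Regular) {κ : ℝ → ℝ} (hκ : Integrable κ L.leb) :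
    C(Icc L.a L.b, ℂ) := ⟨fun x => (hL.expWeight hκ x : ℂ), by fun_prop⟩

/-- The inverse of the exponential weight. -/
def Regular.cWeightInv (hL : L.Regular) {κ : ℝ → ℝ} (hκ : Integrable κ L.leb) :
    C(Icc L.a L.b, ℂ) :=
  ⟨fun x => ((hL.expWeight hκ x)⁻¹ : ℝ), Complex.continuous_ofReal.comp
    ((hL.expWeight hκ).continuous.inv₀ fun x => (hL.expWeight_pos hκ x).ne')⟩

theorem Regular.cWeight_mul_inv (hL : L.Regular) {κ : ℝ → ℝ} (hκ : Integrable κ L.leb) :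
    hL.cWeight hκ * hL.cWeightInv hκ = 1 := by
  ext x
  have := (hL.expWeight_pos hκ x).ne'
  simp [Regular.cWeight, Regular.cWeightInv, this]

/-- In the weighted norm a Volterra operator has norm at most `1 / 2`. -/
theorem Regular.norm_volterra_weighted_le (hL : L.Regular) {κ : ℝ → ℝ} (hκ : Integrable κ L.leb)
    {k : ℝ → ℂ} (hk : Integrable k L.leb) (hle : ∀ t, ‖k t‖ ≤ κ t) (f : C(Icc L.a L.b, ℂ)) :
    ‖hL.cWeightInv hκ * hL.volterra hk (hL.cWeight hκ * f)‖ ≤ 1 / 2 * ‖f‖ := by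
  refine (ContinuousMap.norm_le _ (by positivity)).mpr fun x => ?_
  have hw := hL.expWeight_pos hκ x
  have hi := hL.intervalIntegrable_left hκ x.2
  have hc : ContinuousOn (fun t => Real.exp (2 * ∫ s in L.a..t, κ s)) (uIcc L.a x) :=
    (hi.absolutelyContinuousOnInterval_intervalIntegral left_mem_uIcc |>.const_mul 2).exp.continuousOn
  have hint := (hi.mul_continuousOn hc).mul_const ‖f‖
  have h1 : ‖hL.volterra hk (hL.cWeight hκ * f) x‖ ≤ hL.expWeight hκ x / 2 * ‖f‖ := by
    rw [hL.volterra_apply]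
    refine (intervalIntegral.norm_integral_le_of_norm_le x.2.1 ?_ hint).trans ?_
    · refine Filter.Eventually.of_forall fun t ht => ?_
      have ht' : t ∈ Icc L.a L.b := ⟨ht.1.le, ht.2.trans x.2.2⟩
      rw [hL.ext_apply _ ht', ContinuousMap.mul_apply, norm_mul, norm_mul, ← mul_assoc]
      have : ‖hL.cWeight hκ ⟨t, ht'⟩‖ = Real.exp (2 * ∫ s in L.a..t, κ s) := by
        change ‖((Real.exp _ : ℝ) : ℂ)‖ = _
        rw [Complex.norm_real, Real.norm_of_nonneg (Real.exp_pos _).le]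
      rw [this]
      have h0 : 0 ≤ κ t := (norm_nonneg _).trans (hle t)
      gcongr
      · exact hle t
      · exact f.norm_coe_le_norm _
    · rw [intervalIntegral.integral_mul_const]
      gcongr
      exact integral_mul_exp_le hi
  have h2 : ‖hL.cWeightInv hκ x‖ = (hL.expWeight hκ x)⁻¹ := by
    change ‖(((hL.expWeight hκ x)⁻¹ : ℝ) : ℂ)‖ = _
    rw [Complex.norm_real, Real.norm_of_nonneg (inv_nonneg.mpr hw.le)]
  rw [ContinuousMap.mul_apply, norm_mul, h2]
  calc (hL.expWeight hκ x)⁻¹ * ‖hL.volterra hk (hL.cWeight hκ * f) x‖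
      ≤ (hL.expWeight hκ x)⁻¹ * (hL.expWeight hκ x / 2 * ‖f‖) := by gcongr
    _ = 1 / 2 * ‖f‖ := by field_simp

/-- Pairs of continuous functions on `[a, b]`: a function and its quasi-derivative. -/
abbrev PairSpace (L : SLCoeff) : Type := C(Icc L.a L.b, ℂ) × C(Icc L.a L.b, ℂ)

/-- The integral operator `(f, g) ↦ (∫ₐˣ k g, ∫ₐˣ l f)`. -/
def Regular.pairOp (hL : L.Regular) {k l : ℝ → ℂ} (hk : Integrable k L.leb)
    (hl : Integrable l L.leb) : L.PairSpace →L[ℂ] L.PairSpace :=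
  ((hL.volterra hk).comp (ContinuousLinearMap.snd ℂ _ _)).prod
    ((hL.volterra hl).comp (ContinuousLinearMap.fst ℂ _ _))

theorem Regular.isUnit_one_sub_pairOp (hL : L.Regular) {k l : ℝ → ℂ} (hk : Integrable k L.leb)
    (hl : Integrable l L.leb) : IsUnit (1 - hL.pairOp hk hl) := by
  -- The sum dominates both kernels, so a single weight serves both components of the pair.
  have hκ : Integrable (fun t => ‖k t‖ + ‖l t‖) L.leb := hk.norm.add hl.norm
  let m : C(Icc L.a L.b, ℂ) → (L.PairSpace →L[ℂ] L.PairSpace) := fun w =>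
    (ContinuousLinearMap.mul ℂ _ w).prodMap (ContinuousLinearMap.mul ℂ _ w)
  have hm : ∀ w w' : C(Icc L.a L.b, ℂ), w * w' = 1 → m w * m w' = 1 := by
    intro w w' h
    refine ContinuousLinearMap.ext fun y => Prod.ext ?_ ?_
    · change w * (w' * y.1) = y.1
      rw [← mul_assoc, h, one_mul]
    · change w * (w' * y.2) = y.2
      rw [← mul_assoc, h, one_mul]
  have h1 := hm _ _ (hL.cWeight_mul_inv hκ)
  have h2 := hm _ _ ((mul_comm _ _).trans (hL.cWeight_mul_inv hκ))
  set P := m (hL.cWeight hκ)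
  set Q := m (hL.cWeightInv hκ)
  have hnorm : ‖Q * hL.pairOp hk hl * P‖ < 1 := by
    refine (ContinuousLinearMap.opNorm_le_bound _ (by norm_num : (0 : ℝ) ≤ 1 / 2)
      fun y => ?_).trans_lt (by norm_num)
    change ‖(hL.cWeightInv hκ * hL.volterra hk (hL.cWeight hκ * y.2),
      hL.cWeightInv hκ * hL.volterra hl (hL.cWeight hκ * y.1))‖ ≤ 1 / 2 * ‖y‖
    rw [Prod.norm_def]
    refine max_le ?_ ?_
    · refine (hL.norm_volterra_weighted_le hκ hk (fun t => ?_) _).trans ?_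
      · have := norm_nonneg (l t)
        linarith
      · gcongr
        exact norm_snd_le y
    · refine (hL.norm_volterra_weighted_le hκ hl (fun t => ?_) _).trans ?_
      · have := norm_nonneg (k t)
        linarith
      · gcongr
        exact norm_fst_le y
  exact isUnit_one_sub_of_conj h1 h2 hnorm

/-! ### The initial value problem as an integral equation -/

theorem Regular.pinv_int (hL : L.Regular) : Integrable (fun t => ((L.p t)⁻¹ : ℂ)) L.leb := by
  simpa using hL.p_inv_int.ofReal (𝕜 := ℂ)

theorem Regular.qz_int (hL : L.Regular) (z : ℂ) :
    Integrable (fun t => (L.q t : ℂ) - z * (L.r t : ℂ)) L.leb :=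
  hL.q_int.ofReal.sub (hL.r_int.ofReal.const_mul z)

/-- The integral operator whose fixed points are the solutions of the initial value problem. -/
def Regular.ivpOp (hL : L.Regular) (z : ℂ) : L.PairSpace →L[ℂ] L.PairSpace :=
  hL.pairOp hL.pinv_int (hL.qz_int z)

/-- Only the kernel `q - z r` depends on `z`, and it does so affinely; the operators at 0 and 1
determine the whole family. -/
theorem Regular.ivpOp_eq (hL : L.Regular) (z : ℂ) :
    hL.ivpOp z = hL.ivpOp 0 + z • (hL.ivpOp 1 - hL.ivpOp 0) := by
  have key : ∀ (w : ℂ) (f : C(Icc L.a L.b, ℂ)) (x : Icc L.a L.b),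
      hL.volterra (hL.qz_int w) f x = (∫ t in L.a..x, (L.q t : ℂ) * hL.ext f t) -
        w * ∫ t in L.a..x, (L.r t : ℂ) * hL.ext f t := by
    intro w f x
    have hq := hL.intervalIntegrable_left (hL.integrable_mul_ext hL.q_int.ofReal f) x.2
    have hr := hL.intervalIntegrable_left (hL.integrable_mul_ext hL.r_int.ofReal f) x.2
    rw [hL.volterra_apply, ← intervalIntegral.integral_const_mul]
    refine Eq.trans ?_ (intervalIntegral.integral_sub hq (hr.const_mul w))
    congr 1
    ext t
    ring
  refine ContinuousLinearMap.ext fun y => Prod.ext ?_ ?_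
  · change hL.volterra hL.pinv_int y.2 = hL.volterra hL.pinv_int y.2 +
      z • (hL.volterra hL.pinv_int y.2 - hL.volterra hL.pinv_int y.2)
    simp
  · change hL.volterra (hL.qz_int z) y.1 = hL.volterra (hL.qz_int 0) y.1 +
      z • (hL.volterra (hL.qz_int 1) y.1 - hL.volterra (hL.qz_int 0) y.1)
    ext x
    simp only [ContinuousMap.add_apply, ContinuousMap.smul_apply, ContinuousMap.sub_apply, key,
      smul_eq_mul]
    ring

/-- The solution of the integral equation `y = h + T y`. -/
def Regular.ivpSol (hL : L.Regular) (z : ℂ) (h : L.PairSpace) : L.PairSpace :=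
  Ring.inverse (1 - hL.ivpOp z) h

theorem Regular.ivpSol_eq (hL : L.Regular) (z : ℂ) (h : L.PairSpace) :
    hL.ivpSol z h = h + hL.ivpOp z (hL.ivpSol z h) := by
  have h1 := Ring.mul_inverse_cancel _ (hL.isUnit_one_sub_pairOp hL.pinv_int (hL.qz_int z))
  have h2 := congrArg (fun T : L.PairSpace →L[ℂ] L.PairSpace => T h) h1
  change hL.ivpSol z h - hL.ivpOp z (hL.ivpSol z h) = h at h2
  exact sub_eq_iff_eq_add.mp h2

theorem Regular.differentiable_ivpSol (hL : L.Regular) (h : L.PairSpace) :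
    Differentiable ℂ fun z => hL.ivpSol z h := by
  have h1 : (fun z => hL.ivpSol z h) =
      fun z => (Ring.inverse (1 - (hL.ivpOp 0 + z • (hL.ivpOp 1 - hL.ivpOp 0))) :
        L.PairSpace →L[ℂ] L.PairSpace) h := by
    ext1 z
    rw [← hL.ivpOp_eq]
    rfl
  rw [h1]
  refine differentiable_inverse_one_sub_apply _ _ (fun z => ?_) h
  rw [← hL.ivpOp_eq]
  exact hL.isUnit_one_sub_pairOp hL.pinv_int (hL.qz_int z)

/-- Existence for the inhomogeneous initial value problem. -/
theorem Regular.ivpSol_spec (hL : L.Regular) (z c d : ℂ) {g : ℝ → ℂ} (hg : Integrable g L.leb)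
    {y : L.PairSpace}
    (hy : y = hL.ivpSol z (ContinuousMap.const _ c, ContinuousMap.const _ d + hL.primitive hg)) :
    ∃ u u₁ : ℝ → ℂ, L.QuasiPair u u₁ ∧
      (∀ᵐ x ∂L.leb, deriv u₁ x = g x + ((L.q x : ℂ) - z * (L.r x : ℂ)) * u x) ∧
      u L.a = c ∧ u₁ L.a = d ∧ u L.b = y.1 ⟨L.b, right_mem_Icc.mpr hL.lt.le⟩ ∧
      u₁ L.b = y.2 ⟨L.b, right_mem_Icc.mpr hL.lt.le⟩ := by
  have hfix := hL.ivpSol_eq z (ContinuousMap.const _ c, ContinuousMap.const _ d + hL.primitive hg)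
  rw [← hy] at hfix
  have i1 := hL.integrable_mul_ext hL.pinv_int y.2
  have i2 := hL.integrable_mul_ext (hL.qz_int z) y.1
  -- Integral formulas, rather than the continuous functions `y.1`, `y.2` themselves, give absolute
  -- continuity and the a.e. derivatives at once. The fixed-point equation identifies the two on [a,
  -- b].
  let u : ℝ → ℂ := fun x => c + ∫ t in L.a..x, ((L.p t)⁻¹ : ℂ) * hL.ext y.2 t
  let u₁ : ℝ → ℂ := fun x => d + ∫ t in L.a..x,
    (g t + ((L.q t : ℂ) - z * (L.r t : ℂ)) * hL.ext y.1 t)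
  have e1 : ∀ x : Icc L.a L.b, u x = y.1 x := by
    intro x
    conv_rhs => rw [hfix]
    rfl
  have e2 : ∀ x : Icc L.a L.b, u₁ x = y.2 x := by
    intro x
    conv_rhs => rw [hfix]
    change d + ∫ t in L.a..x, (g t + ((L.q t : ℂ) - z * (L.r t : ℂ)) * hL.ext y.1 t) =
      (d + ∫ t in L.a..x, g t) + ∫ t in L.a..x, ((L.q t : ℂ) - z * (L.r t : ℂ)) * hL.ext y.1 t
    rw [intervalIntegral.integral_add (hL.intervalIntegrable_left hg x.2)
      (hL.intervalIntegrable_left i2 x.2), add_assoc]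
  have hmem : ∀ᵐ x ∂L.leb, x ∈ Ioo L.a L.b := ae_restrict_mem measurableSet_Ioo
  refine ⟨u, u₁, ⟨hL.ac_integral i1 c, hL.ac_integral (hg.add i2) d, ?_⟩, ?_, ?_, ?_, ?_, ?_⟩
  · filter_upwards [hL.ae_deriv_integral i1 c, hL.p_pos, hmem] with x h1 h2 h3
    have h3' := Ioo_subset_Icc_self h3
    have h4 : (L.p x : ℂ) ≠ 0 := by exact_mod_cast h2.ne'
    rw [h1, hL.ext_apply _ h3', ← e2 ⟨x, h3'⟩]
    field_simp
  · filter_upwards [hL.ae_deriv_integral (hg.add i2) d, hmem] with x h1 h3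
    have h3' := Ioo_subset_Icc_self h3
    have h5 : u x = hL.ext y.1 x := by rw [hL.ext_apply _ h3', ← e1 ⟨x, h3'⟩]
    rw [h5]
    exact h1
  · simp [u]
  · simp [u₁]
  · exact e1 ⟨L.b, _⟩
  · exact e2 ⟨L.b, _⟩

end SLCoeff

/-! ### Green's identity -/

namespace SLCoeff

variable {L : SLCoeff}

theorem Regular.integrable_mul_left (hL : L.Regular) {k : ℝ → ℂ} (hk : Integrable k L.leb)
    {f : ℝ → ℂ} (hf : ContinuousOn f (Icc L.a L.b)) : Integrable (fun t => f t * k t) L.leb := by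
  simpa only [mul_comm] using hL.integrable_mul hk hf

theorem Regular.continuousOn (hL : L.Regular) {u : ℝ → ℂ}
    (hu : AbsolutelyContinuousOnInterval u L.a L.b) : ContinuousOn u (Icc L.a L.b) := by
  simpa only [uIcc_of_le hL.lt.le] using hu.continuousOn

theorem Regular.integrable_mul_normSq (hL : L.Regular) {u : ℝ → ℂ}
    (hu : ContinuousOn u (Icc L.a L.b)) :
    Integrable (fun t => L.r t * Complex.normSq (u t)) L.leb := by
  have h := hL.integrable_mul (hL.integrable_mul hL.r_int.ofReal hu) (hu.star)
  refine h.re.congr (Filter.Eventually.of_forall fun t => ?_)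
  change ((L.r t : ℂ) * u t * star (u t)).re = _
  rw [mul_assoc, Complex.star_def, Complex.mul_conj, Complex.re_ofReal_mul, Complex.ofReal_re]

/-- Green's identity for the imaginary part of the boundary form. -/
theorem Regular.green (hL : L.Regular) {z : ℂ} {u u₁ k : ℝ → ℂ} (hu : L.QuasiPair u u₁)
    (hk : Integrable k L.leb)
    (hode : ∀ᵐ x ∂L.leb, -(deriv u₁ x) + (L.q x : ℂ) * u x = z * (L.r x : ℂ) * u x + k x) :
    (star (L.traceD u) ⬝ᵥ L.traceN u₁).im =
      z.im * ∫ x, L.r x * Complex.normSq (u x) ∂L.leb +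
        ∫ x, (star (u x) * k x).im ∂L.leb := by
  obtain ⟨h1, h2, h3⟩ := hu
  have hc := hL.continuousOn h1
  -- This function is Im(ū u₁). In its derivative the term ū' u₁ = p|u'|² is real and drops out. The
  -- sign in `traceN` makes the boundary form its value at a minus its value at b.
  have hac := (h1.re.mul h2.im).sub (h1.im.mul h2.re)
  have hftc := hac.integral_deriv_eq_sub
  rw [hL.intervalIntegral_eq] at hftc
  have i1 := (hL.integrable_mul_normSq hc).const_mul z.im
  have i2 : Integrable (fun x => (star (u x) * k x).im) L.leb :=
    (hL.integrable_mul_left hk hc.star).im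
  rw [← integral_const_mul, ← integral_add i1 i2]
  have hder : ∀ᵐ x ∂L.leb, deriv ((fun x => (u x).re) * (fun x => (u₁ x).im) -
      (fun x => (u x).im) * (fun x => (u₁ x).re)) x =
      -(z.im * (L.r x * Complex.normSq (u x)) + (star (u x) * k x).im) := by
    filter_upwards [h3, ae_diff h1, ae_diff h2, hode, hL.p_pos] with x e1 d1 d2 e2 hp
    have dre : ∀ {f : ℝ → ℂ}, DifferentiableAt ℝ f x →
        HasDerivAt (fun y => (f y).re) (deriv f x).re x := fun hf =>
      Complex.reCLM.hasFDerivAt.comp_hasDerivAt x hf.hasDerivAt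
    have dim : ∀ {f : ℝ → ℂ}, DifferentiableAt ℝ f x →
        HasDerivAt (fun y => (f y).im) (deriv f x).im x := fun hf =>
      Complex.imCLM.hasFDerivAt.comp_hasDerivAt x hf.hasDerivAt
    rw [(((dre d1).mul (dim d2)).sub ((dim d1).mul (dre d2))).deriv]
    have e3 : deriv u₁ x = (L.q x : ℂ) * u x - z * (L.r x : ℂ) * u x - k x := by
      linear_combination -e2
    rw [e3, e1]
    simp only [Complex.sub_re, Complex.sub_im, Complex.mul_re, Complex.mul_im, Complex.ofReal_re,
      Complex.ofReal_im, Complex.star_def, Complex.conj_re, Complex.conj_im, Complex.normSq_apply]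
    ring
  rw [integral_congr_ae hder, integral_neg] at hftc
  rw [← neg_eq_iff_eq_neg.mpr hftc.symm]
  simp [traceD, traceN, dotProduct, Fin.sum_univ_two]
  ring

/-- A solution with vanishing weighted norm is zero, together with its quasi-derivative. -/
theorem Regular.eq_zero_of_integral (hL : L.Regular) {u u₁ : ℝ → ℂ} (hu : L.QuasiPair u u₁)
    (h0 : ∫ x, L.r x * Complex.normSq (u x) ∂L.leb = 0) :
    L.traceD u = 0 ∧ L.traceN u₁ = 0 := by
  have key : ∀ w : ℝ → ℂ, AbsolutelyContinuousOnInterval w L.a L.b → (∀ᵐ x ∂L.leb, w x = 0) →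
      ∀ x ∈ Icc L.a L.b, w x = 0 := by
    intro w hw hw0
    have hc := hL.continuousOn hw
    have h1 : EqOn w (fun _ => 0) (Ioo L.a L.b) :=
      Measure.eqOn_open_of_ae_eq hw0 isOpen_Ioo (hc.mono Ioo_subset_Icc_self) continuousOn_const
    -- Continuity carries the vanishing to the endpoints, where the traces are taken.
    exact h1.of_subset_closure hc continuousOn_const Ioo_subset_Icc_self
      (closure_Ioo hL.lt.ne).ge
  have hu0 : ∀ x ∈ Icc L.a L.b, u x = 0 := by
    refine key u hu.1 ?_
    have hnn : 0 ≤ᵐ[L.leb] fun x => L.r x * Complex.normSq (u x) := by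
      filter_upwards [hL.r_pos] with x hx
      exact mul_nonneg hx.le (Complex.normSq_nonneg _)
    have h1 := (integral_eq_zero_iff_of_nonneg_ae hnn
      (hL.integrable_mul_normSq (hL.continuousOn hu.1))).mp h0
    filter_upwards [h1, hL.r_pos] with x hx hr
    exact Complex.normSq_eq_zero.mp ((mul_eq_zero.mp hx).resolve_left hr.ne')
  have hv0 : ∀ x ∈ Icc L.a L.b, u₁ x = 0 := by
    refine key u₁ hu.2.1 ?_
    have hmem : ∀ᵐ x ∂L.leb, x ∈ Ioo L.a L.b := ae_restrict_mem measurableSet_Ioo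
    filter_upwards [hu.2.2, hmem] with x h1 h2
    have h3 : u =ᶠ[nhds x] fun _ => 0 := by
      filter_upwards [isOpen_Ioo.mem_nhds h2] with y hy using hu0 y (Ioo_subset_Icc_self hy)
    rw [h1, h3.deriv_eq, deriv_const, mul_zero]
  have ha := left_mem_Icc.mpr hL.lt.le
  have hb := right_mem_Icc.mpr hL.lt.le
  simp [traceD, traceN, hu0 _ ha, hu0 _ hb, hv0 _ ha, hv0 _ hb]

end SLCoeff

/-! ### The boundary form -/

/-- Entrywise this is A J A* = B J B* with its terms regrouped; it says that N D* is Hermitian. -/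
theorem SelfAdjointBC.matD_mul_matN {A B : Matrix (Fin 2) (Fin 2) ℂ} (h : SelfAdjointBC A B) :
    matN A B * (matD A B)ᴴ = matD A B * (matN A B)ᴴ := by
  have h2 := h.2
  have e : ∀ i j, (A * bcJ * Aᴴ) i j = (B * bcJ * Bᴴ) i j := fun i j => by rw [h2]
  ext i j
  have := e i j
  fin_cases i <;> fin_cases j <;>
    simp [matN, matD, bcJ, mul_apply, Fin.sum_univ_two] at this ⊢ <;> linear_combination this

/-- The boundary form in terms of the data of two boundary conditions. -/
theorem boundary_form_eq {A B A' B' : Matrix (Fin 2) (Fin 2) ℂ} (hAB : SelfAdjointBC A B)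
    (hAB' : SelfAdjointBC A' B') (hS : IsUnit (matS A' B' A B)) {x y d : Fin 2 → ℂ}
    (hd : (matS A' B' A B)ᴴ *ᵥ d = matD A B *ᵥ x + matN A B *ᵥ y) :
    star x ⬝ᵥ y - star y ⬝ᵥ x =
      star d ⬝ᵥ (matD A' B' *ᵥ x + matN A' B' *ᵥ y) -
        star (matD A' B' *ᵥ x + matN A' B' *ᵥ y) ⬝ᵥ d := by
  have hN := hAB.matD_mul_matN
  have hN' := hAB'.matD_mul_matN
  have hSdef : matS A' B' A B = matN A' B' * (matD A B)ᴴ - matD A' B' * (matN A B)ᴴ := rfl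
  set S := matS A' B' A B
  set D := matD A B
  set N := matN A B
  set D' := matD A' B'
  set N' := matN A' B'
  have hSu : IsUnit S.det := (isUnit_iff_isUnit_det _).mp hS
  have hSHu : IsUnit Sᴴ.det := by rw [det_conjTranspose]; exact hSu.star
  have hSH : Sᴴ = D * N'ᴴ - N * D'ᴴ := by
    rw [hSdef]
    simp [conjTranspose_mul]
  let T : Matrix (Fin 2 ⊕ Fin 2) (Fin 2 ⊕ Fin 2) ℂ := fromBlocks D N D' N'
  let W : Matrix (Fin 2 ⊕ Fin 2) (Fin 2 ⊕ Fin 2) ℂ := fromBlocks 0 1 (-1) 0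
  let Ki : Matrix (Fin 2 ⊕ Fin 2) (Fin 2 ⊕ Fin 2) ℂ := fromBlocks 0 (-S⁻¹) Sᴴ⁻¹ 0
  -- The diagonal blocks cancel by self-adjointness of each pair; the off-diagonal ones are S* and
  -- -S by definition.
  have hTWT : T * W * Tᴴ = fromBlocks 0 Sᴴ (-S) 0 := by
    simp only [T, W, fromBlocks_multiply, fromBlocks_conjTranspose, mul_zero, mul_one, mul_neg,
      zero_add, add_zero]
    congr 1
    · rw [neg_mul, hN, neg_add_cancel]
    · rw [hSH, neg_mul]
      abel
    · rw [hSdef, neg_mul]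
      abel
    · rw [neg_mul, hN', neg_add_cancel]
  -- `Ki` is the inverse of T W T*. For square matrices a right inverse is also a left inverse, so
  -- the factors may be permuted cyclically, giving T* (T W T*)⁻¹ T = W⁻¹ = -W.
  have hK : T * (W * Tᴴ * Ki) = 1 := by
    rw [← mul_assoc, ← mul_assoc, hTWT]
    simp only [Ki, fromBlocks_multiply, mul_zero, zero_mul, zero_add, add_zero]
    rw [mul_nonsing_inv _ hSHu, neg_mul_neg, mul_nonsing_inv _ hSu, fromBlocks_one]
  have hK' : W * (Tᴴ * Ki * T) = 1 := by
    rw [← mul_eq_one_comm.mp hK]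
    simp only [mul_assoc]
  have hWW : (-W) * W = 1 := by
    simp only [W, fromBlocks_neg, fromBlocks_multiply]
    simp
  have hform : Tᴴ * Ki * T = -W := by
    calc Tᴴ * Ki * T = (-W) * W * (Tᴴ * Ki * T) := by rw [hWW, one_mul]
      _ = -W := by rw [mul_assoc, hK', mul_one]
  set c' := D' *ᵥ x + N' *ᵥ y with hc'
  have hT : T *ᵥ Sum.elim x y = Sum.elim (Sᴴ *ᵥ d) c' := by
    rw [hd]
    simp only [T, fromBlocks_mulVec, Sum.elim_comp_inl, Sum.elim_comp_inr, hc']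
  have h1 : star (Sum.elim x y) ⬝ᵥ ((-W) *ᵥ Sum.elim x y) = star y ⬝ᵥ x - star x ⬝ᵥ y := by
    have : star (Sum.elim x y) = Sum.elim (star x) (star y) := by
      ext i
      cases i <;> rfl
    simp only [W, fromBlocks_neg, fromBlocks_mulVec, this, Sum.elim_comp_inl, Sum.elim_comp_inr]
    rw [sumElim_dotProduct_sumElim]
    simp only [neg_zero, neg_neg, zero_mulVec, one_mulVec, neg_mulVec, zero_add, add_zero,
      dotProduct_neg]
    ring
  have h2 : star (Sum.elim x y) ⬝ᵥ ((Tᴴ * Ki * T) *ᵥ Sum.elim x y) =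
      star c' ⬝ᵥ d - star d ⬝ᵥ c' := by
    have e1 : star (Sum.elim (Sᴴ *ᵥ d) c') = Sum.elim (star d ᵥ* S) (star c') := by
      rw [← conjTranspose_conjTranspose S, ← star_mulVec, conjTranspose_conjTranspose]
      ext i
      cases i <;> rfl
    rw [← mulVec_mulVec, ← mulVec_mulVec, hT, dotProduct_mulVec, ← star_mulVec, hT, e1]
    simp only [Ki, fromBlocks_mulVec, Sum.elim_comp_inl, Sum.elim_comp_inr]
    rw [sumElim_dotProduct_sumElim]
    simp only [mulVec_mulVec, zero_mul, zero_mulVec, zero_add, add_zero, neg_mulVec]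
    rw [nonsing_inv_mul _ hSHu, one_mulVec, dotProduct_neg, dotProduct_mulVec, vecMul_vecMul,
      mul_nonsing_inv _ hSu, vecMul_one]
    ring
  rw [hform, h1] at h2
  linear_combination -h2

namespace SLCoeff

variable {L : SLCoeff}

/-! ### Solutions and the monodromy matrix -/

theorem IsSolution.add {z : ℂ} {u u₁ v v₁ : ℝ → ℂ} (hu : L.IsSolution z u u₁)
    (hv : L.IsSolution z v v₁) : L.IsSolution z (u + v) (u₁ + v₁) := by
  refine ⟨hu.1.add hv.1, ?_⟩
  filter_upwards [hu.2, hv.2, ae_diff hu.1.2.1, ae_diff hv.1.2.1] with x h1 h2 d1 d2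
  rw [deriv_add d1 d2, Pi.add_apply]
  linear_combination h1 + h2

theorem IsSolution.smul {z : ℂ} {u u₁ : ℝ → ℂ} (c : ℂ) (hu : L.IsSolution z u u₁) :
    L.IsSolution z (c • u) (c • u₁) := by
  refine ⟨hu.1.smul c, ?_⟩
  filter_upwards [hu.2, ae_diff hu.1.2.1] with x h1 d1
  rw [deriv_const_smul c d1, Pi.smul_apply, smul_eq_mul, smul_eq_mul]
  linear_combination c * h1

theorem trace_add (A B : Matrix (Fin 2) (Fin 2) ℂ) (u u₁ v v₁ : ℝ → ℂ) :
    L.trace A B (u + v) (u₁ + v₁) = L.trace A B u u₁ + L.trace A B v v₁ := by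
  funext i
  fin_cases i <;> simp [trace] <;> ring

theorem trace_smul (A B : Matrix (Fin 2) (Fin 2) ℂ) (c : ℂ) (u u₁ : ℝ → ℂ) :
    L.trace A B (c • u) (c • u₁) = c • L.trace A B u u₁ := by
  funext i
  fin_cases i <;> simp [trace] <;> ring

theorem Regular.primitive_zero (hL : L.Regular) (h : Integrable (fun _ => (0 : ℂ)) L.leb) :
    hL.primitive h = 0 := by
  ext x
  change ∫ t in L.a..x, (0 : ℂ) = 0
  simp

/-- The values at `b` of the solution of the homogeneous equation with initial data `h`. -/
def Regular.endValue (hL : L.Regular) (z : ℂ) (h : L.PairSpace) : Fin 2 → ℂ :=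
  ![(hL.ivpSol z h).1 ⟨L.b, right_mem_Icc.mpr hL.lt.le⟩,
    (hL.ivpSol z h).2 ⟨L.b, right_mem_Icc.mpr hL.lt.le⟩]

theorem Regular.differentiable_endValue (hL : L.Regular) (h : L.PairSpace) (i : Fin 2) :
    Differentiable ℂ fun z => hL.endValue z h i := by
  have hd := hL.differentiable_ivpSol h
  let e := ContinuousMap.evalCLM (M := ℂ) ℂ (⟨L.b, right_mem_Icc.mpr hL.lt.le⟩ : Icc L.a L.b)
  fin_cases i
  · exact (e.comp (ContinuousLinearMap.fst ℂ _ _)).differentiable.comp hd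
  · exact (e.comp (ContinuousLinearMap.snd ℂ _ _)).differentiable.comp hd

/-- The monodromy matrix, mapping the values `(u(a), u^{[1]}(a))` of a solution to
`(u(b), u^{[1]}(b))`. -/
def Regular.monodromy (hL : L.Regular) (z : ℂ) : Matrix (Fin 2) (Fin 2) ℂ :=
  Matrix.of fun i j => ![hL.endValue z (1, 0) i, hL.endValue z (0, 1) i] j

theorem Regular.differentiable_monodromy (hL : L.Regular) (i j : Fin 2) :
    Differentiable ℂ fun z => hL.monodromy z i j := by
  fin_cases j
  · exact hL.differentiable_endValue (1, 0) i
  · exact hL.differentiable_endValue (0, 1) i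

theorem Regular.exists_solution (hL : L.Regular) (z : ℂ) (v : Fin 2 → ℂ) :
    ∃ u u₁ : ℝ → ℂ, L.IsSolution z u u₁ ∧ ![u L.a, u₁ L.a] = v ∧
      ![u L.b, u₁ L.b] = hL.monodromy z *ᵥ v := by
  have h0 : Integrable (fun _ : ℝ => (0 : ℂ)) L.leb := integrable_zero _ _ _
  obtain ⟨u, u₁, hq, hode, ha, ha', hb, hb'⟩ := hL.ivpSol_spec z (v 0) (v 1) h0 rfl
  -- The solution depends linearly on its initial data, so the columns of the monodromy matrix
  -- suffice.
  have hlin : hL.ivpSol z (ContinuousMap.const _ (v 0),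
      ContinuousMap.const _ (v 1) + hL.primitive h0) =
      v 0 • hL.ivpSol z (1, 0) + v 1 • hL.ivpSol z (0, 1) := by
    rw [hL.primitive_zero, add_zero]
    unfold Regular.ivpSol
    rw [← map_smul, ← map_smul, ← map_add]
    congr 1
    refine Prod.ext ?_ ?_ <;> ext x <;> simp
  rw [hlin] at hb hb'
  refine ⟨u, u₁, ⟨hq, ?_⟩, ?_, ?_⟩
  · filter_upwards [hode] with x hx
    rw [hx]
    ring
  · funext i
    fin_cases i
    · exact ha
    · exact ha'
  · funext i
    fin_cases i
    · refine hb.trans ?_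
      simp [Regular.monodromy, Regular.endValue, mulVec, dotProduct, Fin.sum_univ_two]
      ring
    · refine hb'.trans ?_
      simp [Regular.monodromy, Regular.endValue, mulVec, dotProduct, Fin.sum_univ_two]
      ring

/-- The matrix of boundary values of the solutions in terms of their values at `a`. -/
def Regular.charMat (hL : L.Regular) (A B : Matrix (Fin 2) (Fin 2) ℂ) (z : ℂ) :
    Matrix (Fin 2) (Fin 2) ℂ := A - B * hL.monodromy z

theorem Regular.differentiable_charMat (hL : L.Regular) (A B : Matrix (Fin 2) (Fin 2) ℂ)
    (i j : Fin 2) : Differentiable ℂ fun z => hL.charMat A B z i j := by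
  have := hL.differentiable_monodromy
  simp only [Regular.charMat, Matrix.sub_apply, mul_apply]
  fun_prop

theorem Regular.trace_eq_charMat (hL : L.Regular) (A B : Matrix (Fin 2) (Fin 2) ℂ) {z : ℂ}
    {u u₁ : ℝ → ℂ} {v : Fin 2 → ℂ} (ha : ![u L.a, u₁ L.a] = v)
    (hb : ![u L.b, u₁ L.b] = hL.monodromy z *ᵥ v) :
    L.trace A B u u₁ = hL.charMat A B z *ᵥ v := by
  rw [trace, ha, hb, Regular.charMat, sub_mulVec, mulVec_mulVec]

theorem Regular.green_solution (hL : L.Regular) {z : ℂ} {u u₁ : ℝ → ℂ}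
    (hu : L.IsSolution z u u₁) :
    (star (L.traceD u) ⬝ᵥ L.traceN u₁).im =
      z.im * ∫ x, L.r x * Complex.normSq (u x) ∂L.leb := by
  have := hL.green (k := fun _ => 0) hu.1 (integrable_zero _ _ _)
    (by filter_upwards [hu.2] with x hx; rw [hx, add_zero])
  simpa using this

/-! ### Uniqueness and solvability of the boundary value problem for Im z > 0 -/

theorem star_dotProduct_sub (x y : Fin 2 → ℂ) :
    star x ⬝ᵥ y - star y ⬝ᵥ x = 2 * Complex.I * ((star x ⬝ᵥ y).im : ℂ) := by
  have h : star y ⬝ᵥ x = star (star x ⬝ᵥ y) := by rw [star_dotProduct]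
  rw [h, Complex.star_def, Complex.sub_conj]
  push_cast
  ring

/-- Functions satisfying a self-adjoint boundary condition have real boundary form. -/
theorem im_boundary_form_eq_zero {A B A' B' : Matrix (Fin 2) (Fin 2) ℂ} (hAB : SelfAdjointBC A B)
    (hAB' : SelfAdjointBC A' B') (hS : IsUnit (matS A' B' A B)) {u u₁ : ℝ → ℂ}
    (h : L.trace A B u u₁ = 0) : (star (L.traceD u) ⬝ᵥ L.traceN u₁).im = 0 := by
  rw [trace_eq] at h
  have h1 := boundary_form_eq hAB hAB' hS (d := 0) (by rw [h, mulVec_zero])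
  rw [star_dotProduct_sub] at h1
  simp only [star_zero, zero_dotProduct, dotProduct_zero, sub_zero, mul_eq_zero,
    OfNat.ofNat_ne_zero, Complex.I_ne_zero, Complex.ofReal_eq_zero, false_or] at h1
  exact h1

/-- The boundary form is real, so Green's identity leaves Im z ∫ r|u|² = 0: a symmetric operator has
no nonreal eigenvalue. -/
theorem Regular.traces_eq_zero (hL : L.Regular) {A B A' B' : Matrix (Fin 2) (Fin 2) ℂ}
    (hAB : SelfAdjointBC A B) (hAB' : SelfAdjointBC A' B') (hS : IsUnit (matS A' B' A B))
    {z : ℂ} (hz : z ∈ upperHalf) {u u₁ : ℝ → ℂ} (hu : L.IsSolution z u u₁)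
    (h : L.trace A B u u₁ = 0) : L.traceD u = 0 ∧ L.traceN u₁ = 0 := by
  refine hL.eq_zero_of_integral hu.1 ?_
  have h1 := hL.green_solution hu
  rw [im_boundary_form_eq_zero hAB hAB' hS h] at h1
  exact (mul_eq_zero.mp h1.symm).resolve_left (ne_of_gt hz)

/-- A kernel vector would be the initial data at a of a solution with γ_{A,B} u = 0, and such data
vanish. -/
theorem Regular.isUnit_det_charMat (hL : L.Regular) {A B A' B' : Matrix (Fin 2) (Fin 2) ℂ}
    (hAB : SelfAdjointBC A B) (hAB' : SelfAdjointBC A' B') (hS : IsUnit (matS A' B' A B))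
    {z : ℂ} (hz : z ∈ upperHalf) : IsUnit (hL.charMat A B z).det := by
  rw [isUnit_iff_ne_zero]
  intro h0
  obtain ⟨v, hv, hv0⟩ := exists_mulVec_eq_zero_iff.mpr h0
  obtain ⟨u, u₁, hu, ha, hb⟩ := hL.exists_solution z v
  have h1 := hL.traces_eq_zero hAB hAB' hS hz hu
    ((hL.trace_eq_charMat A B ha hb).trans hv0)
  refine hv ?_
  rw [← ha]
  funext i
  fin_cases i
  · exact congrFun h1.1 0
  · exact congrFun h1.2 0

/-- The initial data at a are recovered from `c` by inverting the characteristic matrix; a second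
characteristic matrix then reads off the other trace. -/
theorem Regular.exists_solution_trace (hL : L.Regular) {A B A' B' : Matrix (Fin 2) (Fin 2) ℂ}
    (hAB : SelfAdjointBC A B) (hAB' : SelfAdjointBC A' B') (hS : IsUnit (matS A' B' A B))
    {z : ℂ} (hz : z ∈ upperHalf) (c : Fin 2 → ℂ) :
    ∃ u u₁ : ℝ → ℂ, L.IsSolution z u u₁ ∧ L.trace A B u u₁ = c ∧
      L.trace A' B' u u₁ = (hL.charMat A' B' z * (hL.charMat A B z)⁻¹) *ᵥ c := by
  obtain ⟨u, u₁, hu, ha, hb⟩ := hL.exists_solution z ((hL.charMat A B z)⁻¹ *ᵥ c)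
  refine ⟨u, u₁, hu, ?_, ?_⟩
  · rw [hL.trace_eq_charMat A B ha hb, mulVec_mulVec,
      mul_nonsing_inv _ (hL.isUnit_det_charMat hAB hAB' hS hz), one_mulVec]
  · rw [hL.trace_eq_charMat A' B' ha hb, mulVec_mulVec]

/-! ### The resolvent set -/

theorem Regular.aemeasurable_density (hL : L.Regular) :
    AEMeasurable (fun x => ENNReal.ofReal (L.r x)) L.leb :=
  hL.r_int.aemeasurable.ennreal_ofReal

theorem Regular.isFiniteMeasure_weight (hL : L.Regular) : IsFiniteMeasure L.weight :=
  isFiniteMeasure_withDensity_ofReal hL.r_int.2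

theorem Regular.leb_ac_weight (hL : L.Regular) : L.leb ≪ L.weight := by
  refine withDensity_absolutelyContinuous' hL.aemeasurable_density ?_
  filter_upwards [hL.r_pos] with x hx
  simpa using hx

theorem Regular.integrable_mul_of_weight (hL : L.Regular) {f : ℝ → ℂ}
    (hf : Integrable f L.weight) : Integrable (fun x => (L.r x : ℂ) * f x) L.leb := by
  rw [weight, integrable_withDensity_iff_integrable_smul₀' hL.aemeasurable_density
    (Filter.Eventually.of_forall fun _ => ENNReal.ofReal_lt_top)] at hf
  refine hf.congr ?_
  filter_upwards [hL.r_pos] with x hx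
  rw [ENNReal.toReal_ofReal hx.le, Complex.real_smul]

theorem Regular.integral_weight (hL : L.Regular) (f : ℝ → ℂ) :
    ∫ x, f x ∂L.weight = ∫ x, (L.r x : ℂ) * f x ∂L.leb := by
  rw [weight, integral_withDensity_eq_integral_toReal_smul₀ hL.aemeasurable_density
    (Filter.Eventually.of_forall fun _ => ENNReal.ofReal_lt_top)]
  refine integral_congr_ae ?_
  filter_upwards [hL.r_pos] with x hx
  rw [ENNReal.toReal_ofReal hx.le, Complex.real_smul]

theorem Regular.memLp_of_continuousOn (hL : L.Regular) {u : ℝ → ℂ}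
    (hu : ContinuousOn u (Icc L.a L.b)) : MemLp u 2 L.weight := by
  have := hL.isFiniteMeasure_weight
  obtain ⟨C, hC⟩ := isCompact_Icc.exists_bound_of_continuousOn hu
  have hm : AEStronglyMeasurable u L.leb :=
    (hu.mono Ioo_subset_Icc_self).aestronglyMeasurable measurableSet_Ioo
  refine MemLp.of_bound (hm.mono_ac weight_ac) C (weight_ac ?_)
  filter_upwards [ae_restrict_mem (μ := volume) (measurableSet_Ioo (a := L.a) (b := L.b))] with x hx
  exact hC x (Ioo_subset_Icc_self hx)

theorem Regular.integrable_r_mul (hL : L.Regular) (h : L.L2) :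
    Integrable (fun x => (L.r x : ℂ) * h x) L.leb := by
  have := hL.isFiniteMeasure_weight
  exact hL.integrable_mul_of_weight ((Lp.memLp h).integrable (by norm_num))

/-- The range of `H_{A,B} - z` is the whole space. -/
theorem Regular.exists_mem_extGraph (hL : L.Regular) {A B A' B' : Matrix (Fin 2) (Fin 2) ℂ}
    (hAB : SelfAdjointBC A B) (hAB' : SelfAdjointBC A' B') (hS : IsUnit (matS A' B' A B))
    {z : ℂ} (hz : z ∈ upperHalf) (h : L.L2) :
    ∃ f : L.L2, (f, h + z • f) ∈ L.extGraph A B := by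
  -- A particular solution with source `-r h` ignores the boundary condition; adding a homogeneous
  -- solution with the opposite trace restores it.
  obtain ⟨w, w₁, hw, hode, -⟩ := hL.ivpSol_spec z 0 0 (hL.integrable_r_mul h).neg rfl
  obtain ⟨v, v₁, hv, ht, -⟩ := hL.exists_solution_trace hAB hAB' hS hz (-L.trace A B w w₁)
  have hq := hw.add hv.1
  have hmem := hL.memLp_of_continuousOn (hL.continuousOn hq.1)
  refine ⟨hmem.toLp, w + v, w₁ + v₁, ⟨hq, hmem.coeFn_toLp, ?_⟩, ?_⟩
  · have hr : ∀ᵐ x ∂L.weight, 0 < L.r x := weight_ac hL.r_pos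
    filter_upwards [hmem.coeFn_toLp, Lp.coeFn_add h (z • hmem.toLp),
      Lp.coeFn_smul z hmem.toLp, weight_ac hode, weight_ac hv.2,
      weight_ac (ae_diff hw.2.1), weight_ac (ae_diff hv.1.2.1), hr]
      with x e1 e2 e3 e4 e5 d1 d2 e6
    have hr0 : (L.r x : ℂ) ≠ 0 := by exact_mod_cast e6.ne'
    rw [e2, Pi.add_apply, e3, Pi.smul_apply, e1, tau, deriv_add d1 d2, Pi.add_apply, e4,
      smul_eq_mul, eq_inv_mul_iff_mul_eq₀ hr0]
    simp only [Pi.neg_apply]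
    linear_combination -e5
  · rw [trace_add, ht, add_neg_cancel]

theorem Regular.inner_eq (hL : L.Regular) (f g : L.L2) :
    inner ℂ f g = ∫ x, star (f x) * ((L.r x : ℂ) * g x) ∂L.leb := by
  rw [L2.inner_def, hL.integral_weight]
  refine integral_congr_ae (Filter.Eventually.of_forall fun x => ?_)
  simp only [RCLike.inner_apply, Complex.star_def]
  ring

theorem Regular.integrable_star_mul (hL : L.Regular) (f g : L.L2) :
    Integrable (fun x => star (f x) * ((L.r x : ℂ) * g x)) L.leb := by
  refine (hL.integrable_mul_of_weight (L2.integrable_inner (𝕜 := ℂ) f g)).congr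
    (Filter.Eventually.of_forall fun x => ?_)
  simp only [RCLike.inner_apply, Complex.star_def]
  ring

/-- The lower bound `Im z ‖f‖ ≤ ‖(H_{A,B} - z) f‖`. -/
theorem Regular.im_mul_norm_le (hL : L.Regular) {A B A' B' : Matrix (Fin 2) (Fin 2) ℂ}
    (hAB : SelfAdjointBC A B) (hAB' : SelfAdjointBC A' B') (hS : IsUnit (matS A' B' A B))
    {z : ℂ} {f h : L.L2} (hf : (f, h + z • f) ∈ L.extGraph A B) : z.im * ‖f‖ ≤ ‖h‖ := by
  obtain ⟨u, u₁, ⟨hq, hfu, hg⟩, ht⟩ := hf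
  have hfu' : ∀ᵐ x ∂L.leb, f x = u x := hL.leb_ac_weight hfu
  have hode : ∀ᵐ x ∂L.leb, -(deriv u₁ x) + (L.q x : ℂ) * u x =
      z * (L.r x : ℂ) * u x + (L.r x : ℂ) * h x := by
    filter_upwards [hfu', hL.leb_ac_weight hg, hL.leb_ac_weight (Lp.coeFn_add h (z • f)),
      hL.leb_ac_weight (Lp.coeFn_smul z f), hL.r_pos] with x e1 e2 e3 e4 e5
    have hr0 : (L.r x : ℂ) ≠ 0 := by exact_mod_cast e5.ne'
    have e6 : h x + z * u x = L.tau u u₁ x := by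
      rw [← e2, ← e1]
      rw [e3, Pi.add_apply, e4, Pi.smul_apply, smul_eq_mul]
    rw [tau, eq_inv_mul_iff_mul_eq₀ hr0] at e6
    linear_combination -e6
  have hgreen := hL.green hq (hL.integrable_r_mul h) hode
  rw [im_boundary_form_eq_zero hAB hAB' hS ht] at hgreen
  have hnorm : ∫ x, L.r x * Complex.normSq (u x) ∂L.leb = ‖f‖ ^ 2 := by
    have h1 : ((‖f‖ ^ 2 : ℝ) : ℂ) = inner ℂ f f := by
      rw [inner_self_eq_norm_sq_to_K]
      norm_cast
    have h2 : ((∫ x, L.r x * Complex.normSq (u x) ∂L.leb : ℝ) : ℂ) = inner ℂ f f := by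
      rw [hL.inner_eq, ← integral_complex_ofReal]
      refine integral_congr_ae ?_
      filter_upwards [hfu'] with x hx
      rw [hx, Complex.ofReal_mul, Complex.normSq_eq_conj_mul_self, Complex.star_def]
      ring
    exact_mod_cast h2.trans h1.symm
  have him : ∫ x, (star (u x) * ((L.r x : ℂ) * h x)).im ∂L.leb = (inner ℂ f h).im := by
    rw [hL.inner_eq]
    refine Eq.trans (integral_congr_ae ?_) (integral_im (hL.integrable_star_mul f h))
    filter_upwards [hfu'] with x hx
    rw [hx]
    rfl
  rw [hnorm, him] at hgreen
  -- Green's identity now reads 0 = Im z ‖f‖² + Im⟨f, h⟩, so Cauchy-Schwarz and division by ‖f‖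
  -- finish.
  have h3 : -(inner ℂ f h).im ≤ ‖f‖ * ‖h‖ :=
    ((neg_le_abs _).trans (Complex.abs_im_le_norm _)).trans (norm_inner_le_norm f h)
  rcases (norm_nonneg f).eq_or_lt with h0 | h0
  · rw [← h0, mul_zero]
    exact norm_nonneg h
  · refine le_of_mul_le_mul_right ?_ h0
    nlinarith

/-- A point at which `T - z` is onto and bounded from below belongs to the resolvent set. -/
theorem mem_opResolventSet_of_graph {E : Type*} [NormedAddCommGroup E] [NormedSpace ℂ E]
    {T : E →ₗ.[ℂ] E} {z : ℂ} {ε : ℝ} (hε : 0 < ε) (hex : ∀ h : E, ∃ f, (f, h + z • f) ∈ T.graph)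
    (hle : ∀ f h : E, (f, h + z • f) ∈ T.graph → ε * ‖f‖ ≤ ‖h‖) : z ∈ opResolventSet T := by
  -- The lower bound with `h = 0` gives injectivity, which makes the chosen preimages linear and the
  -- inverse two-sided.
  have huniq : ∀ {f f' h : E}, (f, h + z • f) ∈ T.graph → (f', h + z • f') ∈ T.graph → f = f' := by
    intro f f' h h1 h2
    have h3 := T.graph.sub_mem h1 h2
    have h4 : ((f, h + z • f) - (f', h + z • f') : E × E) = (f - f', 0 + z • (f - f')) := by
      rw [Prod.mk_sub_mk, smul_sub]
      congr 1
      abel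
    rw [h4] at h3
    have h5 := hle _ _ h3
    rw [norm_zero] at h5
    have h6 : ‖f - f'‖ ≤ 0 := by
      by_contra! hlt
      exact absurd h5 (not_le.mpr (mul_pos hε hlt))
    exact sub_eq_zero.mp (norm_le_zero_iff.mp h6)
  choose R hR using hex
  let R₀ : E →ₗ[ℂ] E :=
    { toFun := R
      map_add' := fun x y => by
        refine huniq (hR _) ?_
        have h1 := T.graph.add_mem (hR x) (hR y)
        have h2 : ((R x, x + z • R x) + (R y, y + z • R y) : E × E) =
            (R x + R y, x + y + z • (R x + R y)) := by
          rw [Prod.mk_add_mk, smul_add]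
          congr 1
          abel
        rwa [h2] at h1
      map_smul' := fun c x => by
        refine huniq (hR _) ?_
        have h1 := T.graph.smul_mem c (hR x)
        have h2 : (c • (R x, x + z • R x) : E × E) = (c • R x, c • x + z • c • R x) := by
          rw [Prod.smul_mk, smul_add, smul_comm c z]
        rwa [h2] at h1 }
  refine ⟨R₀.mkContinuous ε⁻¹ fun x => ?_, fun f => ?_, fun u => ?_⟩
  · rw [← div_eq_inv_mul, le_div_iff₀ hε, mul_comm]
    exact hle _ _ (hR x)
  · obtain ⟨y, hy1, hy2⟩ := T.mem_graph_iff.mp (hR f)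
    change (y : E) = R f at hy1
    change T y = f + z • R f at hy2
    have hmem : R f ∈ T.domain := hy1 ▸ y.2
    refine ⟨hmem, ?_⟩
    change T ⟨R f, hmem⟩ - z • R f = f
    have : y = ⟨R f, hmem⟩ := Subtype.ext hy1
    rw [← this, hy2, add_sub_cancel_right]
  · refine huniq (h := T u - z • (u : E)) (hR _) ?_
    rw [sub_add_cancel]
    exact T.mem_graph u

theorem Regular.upperHalf_subset (hL : L.Regular) {A B A' B' : Matrix (Fin 2) (Fin 2) ℂ}
    (hAB : SelfAdjointBC A B) (hAB' : SelfAdjointBC A' B') (hS : IsUnit (matS A' B' A B)) :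
    upperHalf ⊆ opResolventSet (L.opH A B) := by
  intro z hz
  refine mem_opResolventSet_of_graph (ε := z.im) hz ?_ ?_ <;> rw [opH_graph hL]
  · exact fun h => hL.exists_mem_extGraph hAB hAB' hS hz h
  · exact fun f h hf => hL.im_mul_norm_le hAB hAB' hS hf

/-! ### The boundary data map -/

theorem Regular.boundaryDataMap_eq (hL : L.Regular) {A B A' B' : Matrix (Fin 2) (Fin 2) ℂ}
    (hAB : SelfAdjointBC A B) (hAB' : SelfAdjointBC A' B') (hS : IsUnit (matS A' B' A B))
    {z : ℂ} (hz : z ∈ upperHalf) :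
    L.boundaryDataMap A B A' B' z = hL.charMat A' B' z * (hL.charMat A B z)⁻¹ := by
  rw [boundaryDataMap, if_pos (hL.upperHalf_subset hAB hAB' hS hz)]
  ext i j
  obtain ⟨u, u₁, hu, ht, ht'⟩ := hL.exists_solution_trace hAB hAB' hS hz (Pi.single j 1)
  have hspec : L.IsSolution z (L.bvpSol A B z (Pi.single j 1)).1
      (L.bvpSol A B z (Pi.single j 1)).2 ∧ L.trace A B (L.bvpSol A B z (Pi.single j 1)).1
      (L.bvpSol A B z (Pi.single j 1)).2 = Pi.single j 1 :=
    Classical.epsilon_spec (p := fun w : (ℝ → ℂ) × (ℝ → ℂ) =>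
      L.IsSolution z w.1 w.2 ∧ L.trace A B w.1 w.2 = Pi.single j 1) ⟨(u, u₁), hu, ht⟩
  obtain ⟨hw, hwt⟩ := hspec
  set w := L.bvpSol A B z (Pi.single j 1)
  -- The difference of two solutions with the same trace has zero boundary values, so the choice
  -- made in `bvpSol` does not matter.
  have h0 := hL.traces_eq_zero hAB hAB' hS hz (hw.add (hu.smul (-1)))
    (by rw [trace_add, trace_smul, ht, hwt, neg_one_smul, add_neg_cancel])
  have h1 : L.trace A' B' (w.1 + (-1 : ℂ) • u) (w.2 + (-1 : ℂ) • u₁) = 0 := by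
    rw [trace_eq, h0.1, h0.2, mulVec_zero, mulVec_zero, add_zero]
  rw [trace_add, trace_smul, neg_one_smul, ← sub_eq_add_neg, sub_eq_zero] at h1
  rw [of_apply, h1, ht', mulVec_single_one]
  rfl

theorem isOpen_upperHalf : IsOpen upperHalf := isOpen_lt continuous_const Complex.continuous_im

/-- By Cramer's rule the entries are polynomials in entire functions divided by a determinant with
no zero in the upper half-plane. -/
theorem Regular.differentiableOn_boundaryDataMap (hL : L.Regular)
    {A B A' B' : Matrix (Fin 2) (Fin 2) ℂ} (hAB : SelfAdjointBC A B)
    (hAB' : SelfAdjointBC A' B') (hS : IsUnit (matS A' B' A B)) (i j : Fin 2) :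
    DifferentiableOn ℂ (fun z => L.boundaryDataMap A B A' B' z i j) upperHalf := by
  have h1 : ∀ i j, DifferentiableOn ℂ (fun z => hL.charMat A B z i j) upperHalf :=
    fun i j => (hL.differentiable_charMat A B i j).differentiableOn
  have h2 : ∀ i j, DifferentiableOn ℂ (fun z => hL.charMat A' B' z i j) upperHalf :=
    fun i j => (hL.differentiable_charMat A' B' i j).differentiableOn
  have hdet : DifferentiableOn ℂ (fun z => (hL.charMat A B z).det) upperHalf := by
    simp only [det_fin_two]
    fun_prop
  have hinv : DifferentiableOn ℂ (fun z => (hL.charMat A B z).det⁻¹) upperHalf :=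
    hdet.inv fun z hz => (hL.isUnit_det_charMat hAB hAB' hS hz).ne_zero
  have hadj : ∀ i j, DifferentiableOn ℂ (fun z => (hL.charMat A B z).adjugate i j) upperHalf := by
    intro i j
    simp only [adjugate_fin_two]
    fin_cases i <;> fin_cases j <;> simp <;> fun_prop
  refine DifferentiableOn.congr
    (f := fun z => ∑ k, hL.charMat A' B' z i k *
      ((hL.charMat A B z).det⁻¹ * (hL.charMat A B z).adjugate k j)) ?_ fun z hz => ?_
  · fun_prop
  · rw [hL.boundaryDataMap_eq hAB hAB' hS hz, mul_apply]
    simp [inv_def, Ring.inverse_eq_inv']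

/-- Taking the solution with γ_{A,B} u = S*d turns the quadratic form of Im M(z) at d into the
boundary form of u, which Green's identity evaluates as Im z ∫ r|u|². -/
theorem Regular.posDef_matIm (hL : L.Regular) {A B A' B' : Matrix (Fin 2) (Fin 2) ℂ}
    (hAB : SelfAdjointBC A B) (hAB' : SelfAdjointBC A' B') (hS : IsUnit (matS A' B' A B))
    {z : ℂ} (hz : z ∈ upperHalf) :
    (matIm (L.boundaryDataMap A B A' B' z * (matS A' B' A B)ᴴ)).PosDef := by
  refine PosDef.of_dotProduct_mulVec_pos ?_ fun d hd => ?_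
  · rw [IsHermitian, matIm, conjTranspose_smul, conjTranspose_sub, conjTranspose_conjTranspose,
      ← neg_sub, smul_neg, ← neg_smul]
    congr 1
    simp
  set M := L.boundaryDataMap A B A' B' z * (matS A' B' A B)ᴴ with hM
  obtain ⟨u, u₁, hu, ht, ht'⟩ := hL.exists_solution_trace hAB hAB' hS hz
    ((matS A' B' A B)ᴴ *ᵥ d)
  rw [mulVec_mulVec, ← hL.boundaryDataMap_eq hAB hAB' hS hz, ← hM] at ht'
  have hform := boundary_form_eq hAB hAB' hS (ht.symm.trans (trace_eq L A B u u₁))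
  rw [← trace_eq, ht', star_dotProduct_sub] at hform
  have hval : star d ⬝ᵥ matIm M *ᵥ d = ((star (L.traceD u) ⬝ᵥ L.traceN u₁).im : ℂ) := by
    rw [matIm, smul_mulVec, dotProduct_smul, sub_mulVec, dotProduct_sub]
    rw [star_mulVec, ← dotProduct_mulVec] at hform
    rw [← hform, smul_eq_mul, inv_mul_cancel_left₀ (by simp)]
  rw [hval, hL.green_solution hu]
  have hnn : 0 ≤ ∫ x, L.r x * Complex.normSq (u x) ∂L.leb := by
    refine integral_nonneg_of_ae ?_
    filter_upwards [hL.r_pos] with x hx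
    exact mul_nonneg hx.le (Complex.normSq_nonneg _)
  -- If the integral were zero, all boundary values of u would vanish, so S*d = 0 and d = 0 by
  -- invertibility of S.
  refine Complex.zero_lt_real.mpr (mul_pos hz (hnn.lt_of_ne' fun h0 => hd ?_))
  obtain ⟨hD, hN⟩ := hL.eq_zero_of_integral hu.1 h0
  rw [trace_eq, hD, hN, mulVec_zero, mulVec_zero, add_zero] at ht
  have hSu : IsUnit (matS A' B' A B)ᴴ.det := by
    rw [det_conjTranspose]
    exact ((isUnit_iff_isUnit_det _).mp hS).star
  rw [← one_mulVec d, ← nonsing_inv_mul _ hSu, ← mulVec_mulVec, ← ht, mulVec_zero]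

end SLCoeff

end

theorem corollaryc4p11 (L : SLCoeff) (hL : L.Regular)
    (A B A' B' : Matrix (Fin 2) (Fin 2) ℂ)
    (hAB : SelfAdjointBC A B) (hAB' : SelfAdjointBC A' B')
    (hS : IsUnit (matS A' B' A B)) :
    upperHalf ⊆ opResolventSet (L.opH A B) ∧
      IsNevanlinnaHerglotz
        (fun z => L.boundaryDataMap A B A' B' z * (matS A' B' A B).conjTranspose) ∧
      ∀ z ∈ upperHalf,
        (matIm (L.boundaryDataMap A B A' B' z * (matS A' B' A B).conjTranspose)).PosDef := by
  refine ⟨hL.upperHalf_subset hAB hAB' hS, ⟨fun i j => ?_, fun z hz => ?_⟩, fun z hz => ?_⟩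
  · refine DifferentiableOn.analyticOnNhd ?_ SLCoeff.isOpen_upperHalf
    have := hL.differentiableOn_boundaryDataMap hAB hAB' hS
    simp only [Matrix.mul_apply]
    fun_prop
  · exact (hL.posDef_matIm hAB hAB' hS hz).posSemidef
  · exact hL.posDef_matIm hAB hAB' hS hz
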